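/- **Setting.** Let $(X,d)$ be a locally compact, separable, complete metric space with at least two points, let $m$ be a Radon measure on $X$ with full topological support, and let $p\in(1,\infty)$. A *$p$-energy form* is a linear space $\mathcal F$ of ($m$-classes of) measurable functions with $\mathcal E:\mathcal F\to[0,\infty)$ such that $\mathcal E^{1/p}$ is a seminorm. Let $(\mathcal E_p,\mathcal F_p)$ be a $p$-energy form with $\mathcal F_p\subset L^p(X,m)$ and let $\{\Gamma_p\langle u\rangle\}_{u\in\mathcal F_p}$ be finite Borel measures on $X$ such that: 1. for $u\in\mathcal F_p$ and every $1$-Lipschitz $\varphi:\mathbb R\to\mathbb R$ with $\varphi(0)=0$, $\varphi(u)\in\mathcal F_p$ and $\mathcal E_p(\varphi(u))\le\mathcal E_p(u)$; moreover $\mathcal E_p(u)=0$ implies that $u$ is $m$-a.e. constant; 2. $\mathcal F_p$ with the norm $\|u\|_{L^p}+\mathcal E_p(u)^{1/p}$ is a reflexive Banach space; 3. $\mathcal F_p\cap C_c(X)$ is dense in $\mathcal F_p$ and in $C_c(X)$ with the uniform norm; 4. for every Borel set $A$, $u\mapsto\Gamma_p\langle u\rangle(A)^{1/p}$ is a seminorm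 on $\mathcal F_p$; 5. $\mathcal E_p(u)=\Gamma_p\langle u\rangle(X)$ for $u\in\mathcal F_p$; 6. if $u,v\in\mathcal F_p\cap C_c(X)$ and $u-v$ is constant on an open set $U$, then $\Gamma_p\langle u\rangle|_U=\Gamma_p\langle v\rangle|_U$. Let $B(x,r)=\{y: d(x,y)<r\}$, and let $\Psi:(0,\infty)\to(0,\infty)$ be a continuous increasing bijection such that, for some $C_\Psi\ge1$ and $\beta_1,\beta_2>0$, $C_\Psi^{-1}(R/r)^{\beta_1}\le\Psi(R)/\Psi(r)\le C_\Psi(R/r)^{\beta_2}$ for all $0<r\le R$. Assume: * (VD) there is $c_D\ge1$ with $m(B(x,2r))\le c_D\,m(B(x,r))$ for all $x\in X$, $r>0$; * PI$_p(\Psi)$: there are $C_P>0$, $A_P\ge1$ such that for all $x\in X$, $r>0$, $u\in\mathcal F_p$, with $u_B=m(B)^{-1}\int_B u\,dm$, $$\int_{B(x,r)}|u-u_{B(x,r)}|^p\,dm\le C_P\Psi(r)\,\Gamma_p\langle u\rangle(B(x,A_Pr));$$ * cap$_p(\Psi)_\le$: there are $C,A_1,A_2>1$ such that for all $x\in X$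 and $0<R<\operatorname{diam}(X)/A_2$, $$\inf\{\mathcal E_p(u): u\in\mathcal F_p,\ u=1\ \text{a.e. on }B(x,R),\ u=0\ \text{a.e. on }X\setminus B(x,A_1R)\}\le C\,\frac{m(B(x,R))}{\Psi(R)}.$$ Let $\{\rho_\varepsilon\}_{\varepsilon>0}$ be nonnegative (finite-valued) measurable functions on $X\times X$ for which there is $C_\rho\in(0,\infty)$ such that one of the following two assumptions holds. **Assumption 1**: (U1), (T) and (L). **Assumption 2**: (U2) and (L). Here: * (U1) there are $d_j(\varepsilon)\ge0$ ($j\in\mathbb N$, $j\ge1$) with $\sum_{j\ge1}d_j(\varepsilon)\le C_\rho$ for all $\varepsilon>0$ and, for all $x\ne y$ with $d(x,y)<1$, $$\rho_\varepsilon(x,y)\le\sum_{j=1}^\infty d_j(\varepsilon)\frac{\mathbf 1_{B(y,2^{-j+1})\setminus B(y,2^{-j})}(x)}{m(B(y,2^{-j+1}))};$$ * (U2) there are $d_j(\varepsilon)\ge0$ with $\sum_{j\ge1}d_j(\varepsilon)\le C_\rho$ for all $\varepsilon>0$ and, for all $x\ne y$, $$\rho_\varepsilon(x,y)\le\sum_{j=1}^\infty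 d_j(\varepsilon)\frac{\mathbf 1_{B(y,2^{-j+1}\varepsilon)\setminus B(y,2^{-j}\varepsilon)}(x)}{m(B(y,2^{-j+1}\varepsilon))};$$ * (T) for all $\delta>0$, $$\lim_{\varepsilon\downarrow0}\operatorname*{ess\,sup}_{y\in X}\int_{X\setminus B(y,\delta)}\frac{\rho_\varepsilon(x,y)}{\Psi(d(x,y))}\,m(dx)=0\quad\text{and}\quad\lim_{\varepsilon\downarrow0}\operatorname*{ess\,sup}_{y\in X}\int_{X\setminus B(y,\delta)}\frac{\rho_\varepsilon(y,x)}{\Psi(d(x,y))}\,m(dx)=0;$$ * (L) there are Radon measures $\nu_\varepsilon$ on $(0,\infty)$ with $\liminf_{\varepsilon\downarrow0}\int_{(0,\delta]}\Psi\,d\nu_\varepsilon\ge C_\rho^{-1}$ for all $\delta>0$ such that, for each $\varepsilon>0$, either $$\rho_\varepsilon(x,y)\ge C_\rho^{-1}\frac{\Psi(d(x,y))}{\Psi(\varepsilon)}\frac{\mathbf 1_{B(y,\varepsilon)}(x)}{m(B(y,\varepsilon))}\quad\text{for all }x\ne y\text{ with }d(x,y)\le1,$$ or $$\rho_\varepsilon(x,y)\ge\Psi(d(x,y))\frac{\nu_\varepsilon((d(x,y),\infty))}{m(B(y,d(x,y)))}\quad\text{for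 all }x\ne y\text{ with }d(x,y)\le1.$$ **Conclusion.** With the integrand understood as $0$ on the diagonal, $$\mathcal F_p=\Bigl\{u\in L^p(X,m):\liminf_{\varepsilon\downarrow0}\int_X\int_X\frac{|u(x)-u(y)|^p}{\Psi(d(x,y))}\rho_\varepsilon(x,y)\,m(dx)\,m(dy)<\infty\Bigr\}$$ $$=\Bigl\{u\in L^p(X,m):\limsup_{\varepsilon\downarrow0}\int_X\int_X\frac{|u(x)-u(y)|^p}{\Psi(d(x,y))}\rho_\varepsilon(x,y)\,m(dx)\,m(dy)<\infty\Bigr\}.$$ -/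

import Mathlib

open MeasureTheory Filter Topology Set
open scoped ENNReal NNReal

noncomputable section

namespace EnergyForms

/-- `Lp ℝ (ENNReal.ofReal p) m` is a normed space when `1 < p`. -/
instance fact_one_le_ofReal {p : ℝ} [hp : Fact (1 < p)] : Fact (1 ≤ ENNReal.ofReal p) :=
  ⟨ENNReal.one_le_ofReal.2 hp.out.le⟩

/-- `E : V → [0, ∞)` is (the functional of) a `p`-energy form on the vector space `V`:
`E ^ (1 / p)` is a seminorm. -/
def IsPEnergy (p : ℝ) {V : Type*} [AddCommGroup V] [Module ℝ V] (E : V → ℝ≥0) : Prop :=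
  ∃ q : Seminorm ℝ V, ∀ u, q u = (E u : ℝ) ^ (1 / p)

/-- A normed space is reflexive if the canonical embedding into its bidual is onto. -/
def IsReflexiveNormed (V : Type*) [NormedAddCommGroup V] [NormedSpace ℝ V] : Prop :=
  Function.Surjective (NormedSpace.inclusionInDoubleDual ℝ V)

/-- A `p`-energy form `(E, F)` on `(X, m)` with `F ⊆ L^p(X, m)`. -/
structure PEnergyForm {X : Type*} [MeasurableSpace X] (m : Measure X) (p : ℝ) where
  /-- the domain -/
  F : Submodule ℝ (Lp ℝ (ENNReal.ofReal p) m)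
  /-- the energy -/
  E : F → ℝ≥0
  isPEnergy : IsPEnergy p E

namespace PEnergyForm

variable {X : Type*} [MeasurableSpace X] {m : Measure X} {p : ℝ}

/-- The domain `F`, as a type of its own: it carries the norm `‖u‖_{L^p} + E(u)^{1/p}`,
not the norm inherited from `L^p`. -/
def Domain (𝓔 : PEnergyForm m p) : Type _ := 𝓔.F

instance (𝓔 : PEnergyForm m p) : AddCommGroup 𝓔.Domain := inferInstanceAs (AddCommGroup 𝓔.F)

instance (𝓔 : PEnergyForm m p) : Module ℝ 𝓔.Domain := inferInstanceAs (Module ℝ 𝓔.F)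

/-- The norm `‖u‖_{L^p} + E(u)^{1/p}` on the domain. -/
def domainNorm (𝓔 : PEnergyForm m p) (u : 𝓔.F) : ℝ :=
  ‖(u : Lp ℝ (ENNReal.ofReal p) m)‖ + (𝓔.E u : ℝ) ^ (1 / p)

theorem domainNorm_add_le [Fact (1 < p)] (𝓔 : PEnergyForm m p) (u v : 𝓔.F) :
    𝓔.domainNorm (u + v) ≤ 𝓔.domainNorm u + 𝓔.domainNorm v := by
  obtain ⟨q, hq⟩ := 𝓔.isPEnergy
  have h1 := norm_add_le (u : Lp ℝ (ENNReal.ofReal p) m) v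
  have h2 := map_add_le_add q u v
  simp only [domainNorm, ← hq, Submodule.coe_add]
  linarith

theorem domainNorm_smul [Fact (1 < p)] (𝓔 : PEnergyForm m p) (c : ℝ) (u : 𝓔.F) :
    𝓔.domainNorm (c • u) = ‖c‖ * 𝓔.domainNorm u := by
  obtain ⟨q, hq⟩ := 𝓔.isPEnergy
  simp only [domainNorm, ← hq, Submodule.coe_smul, map_smul_eq_mul, norm_smul]
  ring

theorem domainNorm_zero [Fact (1 < p)] (𝓔 : PEnergyForm m p) : 𝓔.domainNorm 0 = 0 := by
  simpa using 𝓔.domainNorm_smul 0 0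

theorem domainNorm_neg [Fact (1 < p)] (𝓔 : PEnergyForm m p) (u : 𝓔.F) :
    𝓔.domainNorm (-u) = 𝓔.domainNorm u := by
  simpa using 𝓔.domainNorm_smul (-1) u

instance [Fact (1 < p)] (𝓔 : PEnergyForm m p) : NormedAddCommGroup 𝓔.Domain :=
  AddGroupNorm.toNormedAddCommGroup (E := 𝓔.Domain)
    { toFun := 𝓔.domainNorm
      map_zero' := 𝓔.domainNorm_zero
      add_le' := 𝓔.domainNorm_add_le
      neg' := 𝓔.domainNorm_neg
      eq_zero_of_map_eq_zero' := fun u hu => by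
        have h0 : 0 ≤ (𝓔.E u : ℝ) ^ (1 / p) := Real.rpow_nonneg (NNReal.coe_nonneg _) _
        have h1 := norm_nonneg (Subtype.val u : Lp ℝ (ENNReal.ofReal p) m)
        have h2 : ‖(Subtype.val u : Lp ℝ (ENNReal.ofReal p) m)‖ + (𝓔.E u : ℝ) ^ (1 / p) = 0 := hu
        have h3 : ‖(Subtype.val u : Lp ℝ (ENNReal.ofReal p) m)‖ = 0 := by linarith
        exact Subtype.ext (norm_eq_zero.1 h3) }

instance [Fact (1 < p)] (𝓔 : PEnergyForm m p) : NormedSpace ℝ 𝓔.Domain where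
  norm_smul_le c u := (𝓔.domainNorm_smul c u).le

end PEnergyForm

/-- The function `f` is a continuous compactly supported version of `u`. -/
def IsCcVersion {X : Type*} [MeasurableSpace X] [TopologicalSpace X] {m : Measure X} {q : ℝ≥0∞}
    (u : Lp ℝ q m) (f : X → ℝ) : Prop :=
  Continuous f ∧ HasCompactSupport f ∧ u =ᵐ[m] f

/-- A `p`-energy form with a family of `p`-energy measures `Γ⟨u⟩`: the data and standing
conditions. -/
structure EnergyStructure {X : Type*} [MetricSpace X] [MeasurableSpace X] [BorelSpace X]
    (m : Measure X) (p : ℝ) [Fact (1 < p)] extends PEnergyForm m p where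
  /-- the `p`-energy measures -/
  Γ : F → FiniteMeasure X
  /-- Lipschitz contraction property. (The condition `φ 0 = 0` ensures that `φ(u)` lies in
  `L^p` also when `m` is infinite.) -/
  lipschitz_contraction : ∀ (u : F) (φ : ℝ → ℝ) (hφ : LipschitzWith 1 φ) (h0 : φ 0 = 0),
    ∃ h : hφ.compLp h0 (u : Lp ℝ (ENNReal.ofReal p) m) ∈ F, E ⟨_, h⟩ ≤ E u
  /-- functions of zero energy are constant -/
  const_of_energy_eq_zero : ∀ u : F, E u = 0 →
    ∃ c : ℝ, (u : Lp ℝ (ENNReal.ofReal p) m) =ᵐ[m] fun _ => c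
  /-- with the norm `‖u‖_{L^p} + E(u)^{1/p}`, the domain is a Banach space -/
  complete : CompleteSpace toPEnergyForm.Domain
  reflexive : IsReflexiveNormed toPEnergyForm.Domain
  /-- `F ∩ C_c(X)` is dense in `F` -/
  dense_domain : ∀ (u : F) (ε : ℝ), 0 < ε → ∃ (v : F) (g : X → ℝ),
    IsCcVersion (v : Lp ℝ (ENNReal.ofReal p) m) g ∧ toPEnergyForm.domainNorm (u - v) < ε
  /-- `F ∩ C_c(X)` is uniformly dense in `C_c(X)` -/
  dense_Cc : ∀ f : X → ℝ, Continuous f → HasCompactSupport f → ∀ ε : ℝ, 0 < ε →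
    ∃ (v : F) (g : X → ℝ), IsCcVersion (v : Lp ℝ (ENNReal.ofReal p) m) g ∧
      ∀ x, |f x - g x| < ε
  /-- `u ↦ Γ⟨u⟩(A)` is a `p`-energy form for every Borel set `A` -/
  measure_isPEnergy : ∀ A : Set X, MeasurableSet A → IsPEnergy p fun u : F => Γ u A
  /-- the total mass of `Γ⟨u⟩` is the energy of `u` -/
  measure_univ : ∀ u : F, E u = Γ u univ
  /-- strong locality -/
  strongly_local : ∀ (u v : F) (f g : X → ℝ),
    IsCcVersion (u : Lp ℝ (ENNReal.ofReal p) m) f →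
    IsCcVersion (v : Lp ℝ (ENNReal.ofReal p) m) g →
    ∀ U : Set X, IsOpen U → (∃ c : ℝ, ∀ x ∈ U, f x - g x = c) →
      (Γ u : Measure X).restrict U = (Γ v : Measure X).restrict U

/-- A scale function: a continuous increasing bijection of `(0, ∞)` with two-sided power bounds
on ratios. The values of `Ψ` outside `(0, ∞)` are irrelevant. -/
structure IsScaleFunction (Ψ : ℝ → ℝ) : Prop where
  continuousOn : ContinuousOn Ψ (Ioi 0)
  strictMonoOn : StrictMonoOn Ψ (Ioi 0)
  bijOn : BijOn Ψ (Ioi 0) (Ioi 0)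
  ratio_bounds : ∃ C β₁ β₂ : ℝ, 1 ≤ C ∧ 0 < β₁ ∧ 0 < β₂ ∧ ∀ r R : ℝ, 0 < r → r ≤ R →
    C⁻¹ * (R / r) ^ β₁ ≤ Ψ R / Ψ r ∧ Ψ R / Ψ r ≤ C * (R / r) ^ β₂

section Conditions

variable {X : Type*} [MetricSpace X] [MeasurableSpace X] [BorelSpace X]

/-- The volume doubling property. -/
def VolumeDoubling (m : Measure X) : Prop :=
  ∃ c : ℝ≥0, 1 ≤ c ∧ ∀ (x : X) (r : ℝ), 0 < r →
    m (Metric.ball x (2 * r)) ≤ c * m (Metric.ball x r)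

/-- The `(p,p)`-Poincaré inequality with scale function `Ψ`. -/
def PoincareInequality {m : Measure X} {p : ℝ} [Fact (1 < p)]
    (𝓔 : EnergyStructure m p) (Ψ : ℝ → ℝ) : Prop :=
  ∃ C A : ℝ, 0 < C ∧ 1 ≤ A ∧ ∀ (x : X) (r : ℝ), 0 < r → ∀ u : 𝓔.F,
    ∫⁻ y in Metric.ball x r,
        ENNReal.ofReal (|u.1 y - ⨍ z in Metric.ball x r, u.1 z ∂m| ^ p) ∂m
      ≤ ENNReal.ofReal (C * Ψ r) * (𝓔.Γ u : Measure X) (Metric.ball x (A * r))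

/-- The capacity `inf {E(u) | u ∈ F, u = 1 a.e. on E₁, u = 0 a.e. on E₀}` (with `inf ∅ = ∞`). -/
def capacity {m : Measure X} {p : ℝ} [Fact (1 < p)]
    (𝓔 : EnergyStructure m p) (E₁ E₀ : Set X) : ℝ≥0∞ :=
  ⨅ (u : 𝓔.F) (_ : (∀ᵐ x ∂m, x ∈ E₁ → u.1 x = 1) ∧ (∀ᵐ x ∂m, x ∈ E₀ → u.1 x = 0)),
    (𝓔.E u : ℝ≥0∞)

/-- The `p`-capacity upper estimate with scale function `Ψ`. -/
def CapacityUpperBound {m : Measure X} {p : ℝ} [Fact (1 < p)]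
    (𝓔 : EnergyStructure m p) (Ψ : ℝ → ℝ) : Prop :=
  ∃ C A₁ A₂ : ℝ, 1 < C ∧ 1 < A₁ ∧ 1 < A₂ ∧ ∀ (x : X) (R : ℝ), 0 < R →
    ENNReal.ofReal R < Metric.ediam (univ : Set X) / ENNReal.ofReal A₂ →
    capacity 𝓔 (Metric.ball x R) (Metric.ball x (A₁ * R))ᶜ
      ≤ ENNReal.ofReal C * m (Metric.ball x R) / ENNReal.ofReal (Ψ R)

/-- The dyadic sum `∑ⱼ dⱼ 1_{B(y, 2^{-j} s) \ B(y, 2^{-j-1} s)}(x) / m(B(y, 2^{-j} s))`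
over `j = 0, 1, 2, …`. -/
def dyadicKernel (m : Measure X) (d : ℕ → ℝ≥0) (s : ℝ) (x y : X) : ℝ≥0∞ :=
  ∑' j : ℕ, (d j : ℝ≥0∞) *
    ((Metric.ball y (s / 2 ^ j) \ Metric.ball y (s / 2 ^ (j + 1))).indicator (fun _ => 1) x
      / m (Metric.ball y (s / 2 ^ j)))

/-- The upper kernel bound at fixed scale: for pairs of distinct points at distance less
than `1`. -/
def KernelUpperFixed (m : Measure X) (ρ : ℝ → X → X → ℝ≥0) (C : ℝ) : Prop :=
  ∃ d : ℝ → ℕ → ℝ≥0, ∀ ε : ℝ, 0 < ε →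
    ∑' j, (d ε j : ℝ≥0∞) ≤ ENNReal.ofReal C ∧
    ∀ x y : X, x ≠ y → dist x y < 1 → (ρ ε x y : ℝ≥0∞) ≤ dyadicKernel m (d ε) 1 x y

/-- The upper kernel bound at scale `ε`, for all pairs of distinct points. -/
def KernelUpperLocal (m : Measure X) (ρ : ℝ → X → X → ℝ≥0) (C : ℝ) : Prop :=
  ∃ d : ℝ → ℕ → ℝ≥0, ∀ ε : ℝ, 0 < ε →
    ∑' j, (d ε j : ℝ≥0∞) ≤ ENNReal.ofReal C ∧
    ∀ x y : X, x ≠ y → (ρ ε x y : ℝ≥0∞) ≤ dyadicKernel m (d ε) ε x y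

/-- `ess sup_y ∫_{X \ B(y, δ)} k(x, y) / Ψ(d(x, y)) m(dx)`. -/
def tailBound (m : Measure X) (Ψ : ℝ → ℝ) (k : X → X → ℝ≥0) (δ : ℝ) : ℝ≥0∞ :=
  essSup (fun y => ∫⁻ x in (Metric.ball y δ)ᶜ,
    (k x y : ℝ≥0∞) / ENNReal.ofReal (Ψ (dist x y)) ∂m) m

/-- The off-diagonal mass of the kernel, with respect to either variable, vanishes in the
limit. -/
def KernelTail (m : Measure X) (Ψ : ℝ → ℝ) (ρ : ℝ → X → X → ℝ≥0) : Prop :=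
  ∀ δ : ℝ, 0 < δ →
    Tendsto (fun ε => tailBound m Ψ (fun x y => ρ ε x y) δ) (𝓝[>] 0) (𝓝 0) ∧
    Tendsto (fun ε => tailBound m Ψ (fun x y => ρ ε y x) δ) (𝓝[>] 0) (𝓝 0)

/-- The lower kernel bound: for each `ε` one of the two lower estimates holds for all pairs of
distinct points at distance at most `1`. The measures `ν ε` are Radon measures on `(0, ∞)`
(only their restrictions to `(0, ∞)` matter). -/
def KernelLower (m : Measure X) (Ψ : ℝ → ℝ) (ρ : ℝ → X → X → ℝ≥0) (C : ℝ) : Prop :=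
  ∃ ν : ℝ → Measure ℝ,
    (∀ ε : ℝ, 0 < ε → ∀ a b : ℝ, 0 < a → ν ε (Icc a b) < ∞) ∧
    (∀ δ : ℝ, 0 < δ → ENNReal.ofReal C⁻¹ ≤
      liminf (fun ε => ∫⁻ t in Ioc 0 δ, ENNReal.ofReal (Ψ t) ∂(ν ε)) (𝓝[>] 0)) ∧
    ∀ ε : ℝ, 0 < ε →
      (∀ x y : X, x ≠ y → dist x y ≤ 1 →
        ENNReal.ofReal (C⁻¹ * (Ψ (dist x y) / Ψ ε)) *
            ((Metric.ball y ε).indicator (fun _ => 1) x / m (Metric.ball y ε))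
          ≤ (ρ ε x y : ℝ≥0∞)) ∨
      (∀ x y : X, x ≠ y → dist x y ≤ 1 →
        ENNReal.ofReal (Ψ (dist x y)) *
            (ν ε (Ioi (dist x y)) / m (Metric.ball y (dist x y)))
          ≤ (ρ ε x y : ℝ≥0∞))

/-- First set of conditions on the mollifiers. -/
def KernelAssumption₁ (m : Measure X) (Ψ : ℝ → ℝ) (ρ : ℝ → X → X → ℝ≥0) : Prop :=
  ∃ C : ℝ, 0 < C ∧ KernelUpperFixed m ρ C ∧ KernelTail m Ψ ρ ∧ KernelLower m Ψ ρ C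

/-- Second set of conditions on the mollifiers. -/
def KernelAssumption₂ (m : Measure X) (Ψ : ℝ → ℝ) (ρ : ℝ → X → X → ℝ≥0) : Prop :=
  ∃ C : ℝ, 0 < C ∧ KernelUpperLocal m ρ C ∧ KernelLower m Ψ ρ C

/-- The Besov-type functional `∫∫ |u(x) - u(y)|^p / Ψ(d(x,y)) k(x,y) m(dx) m(dy)`.
The integrand is `0` on the diagonal. -/
def besovFunctional (m : Measure X) (p : ℝ) (Ψ : ℝ → ℝ) (k : X → X → ℝ≥0) (u : X → ℝ) : ℝ≥0∞ :=
  ∫⁻ y, ∫⁻ x, ENNReal.ofReal (|u x - u y| ^ p / Ψ (dist x y)) * (k x y : ℝ≥0∞) ∂m ∂m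

end Conditions

end EnergyForms

end

open EnergyForms

noncomputable section

namespace EnergyForms

/-! ### Weak compactness in reflexive spaces -/

/-! Both inclusions pass through the one-scale functional `ballFunctional`, written Φ_r(u): the
double integral of |u(x)-u(y)|^p / m(B(y,r)) over d(x,y) < r.

Upper bound. The Poincaré inequality, summed over boundedly overlapping balls, gives Φ_r(u) ≤ K Ψ(r)
E(u) at every scale (`PoincareInequality.exists_ballFunctional_le`). The dyadic majorant of the
kernel turns the Besov functional into a sum of terms d_j Φ_{r_j}(u) / Ψ(r_j), hence at most a
multiple of E(u) ∑ d_j. Under the tail condition, pairs at distance at least 1 contribute at most a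
multiple of ‖u‖_p^p. So the upper limit is finite on the domain.

Lower bound. If the lower limit is finite, the lower kernel bound yields arbitrarily small t with
Φ_t(u) ≤ M Ψ(t), for one fixed M (`exists_ballFunctional_le_of_liminf`). At such a scale u is
replaced by w = ∑ a_i ψ_i, where ψ_i is a partition of unity built from capacity bumps on an s-net
with s comparable to t, and a_i are averages of u, cut off to a finite set. Near the net point j, w
differs by a constant from ∑ (a_i - a_j) ψ_i over boundedly many neighbours. By strong locality its
energy there is controlled by differences of coefficients, and in total by Φ_t(u) / Ψ(t) plus a
bounded error (`CapacityUpperBound.exists_approximation`). As t tends to 0 along such scales these w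
stay bounded in the domain and converge to u in L^p, so reflexivity puts u in the domain. Since
liminf ≤ limsup, both sets equal the domain.

Two points need care. Strong locality is assumed only for members of C_c(X), while the bumps need
not be continuous; `energyMeasure_eq_zero_of_const` extends it to bounded functions by weak
closedness of subspaces. Energies are estimated only through sums, scalar multiples and 1-Lipschitz
maps, so the partition of unity comes from running maxima rather than from quotients. -/

/-- A bounded sequence in a reflexive space has a weak limit along any ultrafilter. -/
theorem IsReflexiveNormed.exists_weak_limit {V : Type*} [NormedAddCommGroup V] [NormedSpace ℝ V]
    (hV : IsReflexiveNormed V) (v : ℕ → V) (M : ℝ) (hM : ∀ n, ‖v n‖ ≤ M) (𝒰 : Ultrafilter ℕ) :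
    ∃ x : V, ∀ l : StrongDual ℝ V, Tendsto (fun n => l (v n)) 𝒰 (𝓝 (l x)) := by
  have hM0 : 0 ≤ M := (norm_nonneg _).trans (hM 0)
  have key : ∀ l : StrongDual ℝ V, ∃ c : ℝ, |c| ≤ M * ‖l‖ ∧
      Tendsto (fun n => l (v n)) 𝒰 (𝓝 c) := by
    intro l
    have hc : IsCompact (Metric.closedBall (0 : ℝ) (M * ‖l‖)) := isCompact_closedBall _ _
    obtain ⟨c, hc1, hc2⟩ := hc.ultrafilter_le_nhds (𝒰.map fun n => l (v n)) (by
      refine le_principal_iff.2 (Ultrafilter.mem_coe.2 (Ultrafilter.mem_map.2 ?_))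
      refine univ_mem' fun n => ?_
      simp only [mem_preimage, mem_closedBall_zero_iff]
      calc ‖l (v n)‖ ≤ ‖l‖ * ‖v n‖ := l.le_opNorm _
        _ ≤ M * ‖l‖ := by rw [mul_comm]; gcongr; exact hM n)
    exact ⟨c, by simpa using hc1, hc2⟩
  choose L hL1 hL2 using key
  -- Uniqueness of ultrafilter limits makes `L` linear, and it is bounded by `M`: an element of the
  -- bidual, which reflexivity represents by a vector.
  let Φ₀ : StrongDual ℝ V →ₗ[ℝ] ℝ :=
    { toFun := L
      map_add' := fun a b => tendsto_nhds_unique (hL2 (a + b)) ((hL2 a).add (hL2 b))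
      map_smul' := fun c a => tendsto_nhds_unique (hL2 (c • a)) ((hL2 a).const_mul c) }
  let Φ : StrongDual ℝ (StrongDual ℝ V) := Φ₀.mkContinuous M hL1
  obtain ⟨x, hx⟩ := hV Φ
  refine ⟨x, fun l => ?_⟩
  have : l x = L l := by
    have h := congrArg (fun F => F l) hx
    exact h
  rw [this]
  exact hL2 l

/-- If a bounded sequence of a subspace `S` of a reflexive space converges after applying a
continuous linear map `T`, then the limit is the image of a point of the closure of `S`. -/
theorem IsReflexiveNormed.exists_mem_closure {V W : Type*} [NormedAddCommGroup V]
    [NormedSpace ℝ V] [NormedAddCommGroup W] [NormedSpace ℝ W]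
    (hV : IsReflexiveNormed V) (T : V →L[ℝ] W) (S : Submodule ℝ V) (v : ℕ → V)
    (hv : ∀ n, v n ∈ S) (M : ℝ) (hM : ∀ n, ‖v n‖ ≤ M) (w : W)
    (hw : Tendsto (fun n => T (v n)) atTop (𝓝 w)) :
    ∃ x ∈ closure (S : Set V), T x = w := by
  obtain ⟨x, hx⟩ := hV.exists_weak_limit v M hM (hyperfilter ℕ)
  have hle : ((hyperfilter ℕ : Ultrafilter ℕ) : Filter ℕ) ≤ atTop := by
    rw [← Nat.cofinite_eq_atTop]; exact hyperfilter_le_cofinite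
  refine ⟨x, ?_, ?_⟩
  · by_contra hxS
    obtain ⟨f, s, hf1, hf2⟩ := geometric_hahn_banach_closed_point
      S.topologicalClosure.convex S.isClosed_topologicalClosure hxS
    -- A functional bounded above on a subspace vanishes there: otherwise some multiple of `a`
    -- attains the separating level `s`.
    have hf0 : ∀ a ∈ S, f a = 0 := by
      intro a ha
      by_contra h0
      have := hf1 ((s / f a) • a) (subset_closure (S.smul_mem _ ha))
      rw [map_smul, smul_eq_mul, div_mul_cancel₀ _ h0] at this
      exact lt_irrefl _ this
    have h1 : Tendsto (fun n => f (v n)) (hyperfilter ℕ) (𝓝 0) := by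
      simp only [fun n => hf0 _ (hv n)]
      exact tendsto_const_nhds
    have h2 := tendsto_nhds_unique (hx f) h1
    have h3 := hf1 0 (subset_closure S.zero_mem)
    rw [map_zero] at h3
    linarith
  · refine eq_of_sub_eq_zero (norm_eq_zero.1 ?_)
    by_contra hne
    -- A norming functional for `T x - w` pulls back along `T`, so weak convergence upstairs and
    -- norm convergence downstairs give the same limit.
    obtain ⟨g, -, hg⟩ := exists_dual_vector ℝ (T x - w) hne
    have h1 : Tendsto (fun n => g (T (v n))) (hyperfilter ℕ) (𝓝 (g w)) :=
      ((g.continuous.tendsto w).comp hw).mono_left hle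
    have h2 := tendsto_nhds_unique (hx (g.comp T)) h1
    simp only [ContinuousLinearMap.comp_apply] at h2
    rw [map_sub, h2, sub_self] at hg
    exact hne (by simpa using hg.symm)

/-! ### Energies of functions -/

theorem energy_nonneg {X : Type*} [MeasurableSpace X] {m : Measure X} {p : ℝ}
    (𝓔 : PEnergyForm m p) (u : 𝓔.F) : 0 ≤ (𝓔.E u : ℝ) ^ (1 / p) :=
  Real.rpow_nonneg (NNReal.coe_nonneg _) _

section Energy

variable {X : Type*} [MetricSpace X] [MeasurableSpace X] [BorelSpace X] {m : Measure X} {p : ℝ}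
  [Fact (1 < p)]

theorem one_lt_exponent (p : ℝ) [hp : Fact (1 < p)] : 1 < p := hp.out

/-- The inclusion of the domain of a `p`-energy form into `L^p`. -/
def domainInclusion (𝓔 : PEnergyForm m p) : 𝓔.Domain →L[ℝ] Lp ℝ (ENNReal.ofReal p) m :=
  LinearMap.mkContinuous
    { toFun := fun u => (show 𝓔.F from u).1
      map_add' := fun _ _ => rfl
      map_smul' := fun _ _ => rfl } 1 (fun u => by
        have h0 : 0 ≤ (𝓔.E u : ℝ) ^ (1 / p) := Real.rpow_nonneg (NNReal.coe_nonneg _) _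
        have : ‖u‖ = ‖(show 𝓔.F from u).1‖ + (𝓔.E u : ℝ) ^ (1 / p) := rfl
        rw [one_mul, this]
        exact le_add_of_nonneg_right h0)

/-- The function `f` represents an element of the domain with `E(f)^{1/p} ≤ c`. -/
def HasEnergyLE (𝓔 : EnergyStructure m p) (f : X → ℝ) (c : ℝ) : Prop :=
  ∃ u : 𝓔.F, u.1 =ᵐ[m] f ∧ (𝓔.E u : ℝ) ^ (1 / p) ≤ c

namespace HasEnergyLE

variable {𝓔 : EnergyStructure m p} {f g : X → ℝ} {a b : ℝ}

theorem mono (hf : HasEnergyLE 𝓔 f a) (h : a ≤ b) : HasEnergyLE 𝓔 f b := by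
  obtain ⟨u, h1, h2⟩ := hf
  exact ⟨u, h1, h2.trans h⟩

theorem congr (hf : HasEnergyLE 𝓔 f a) (h : f =ᵐ[m] g) : HasEnergyLE 𝓔 g a := by
  obtain ⟨u, h1, h2⟩ := hf
  exact ⟨u, h1.trans h, h2⟩

theorem zero : HasEnergyLE 𝓔 (fun _ => 0) 0 := by
  obtain ⟨q, hq⟩ := 𝓔.isPEnergy
  refine ⟨0, Lp.coeFn_zero _ _ _, ?_⟩
  rw [← hq, map_zero]

theorem add (hf : HasEnergyLE 𝓔 f a) (hg : HasEnergyLE 𝓔 g b) :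
    HasEnergyLE 𝓔 (fun x => f x + g x) (a + b) := by
  obtain ⟨q, hq⟩ := 𝓔.isPEnergy
  obtain ⟨u, hu, hua⟩ := hf
  obtain ⟨v, hv, hvb⟩ := hg
  refine ⟨u + v, (Lp.coeFn_add _ _).trans (hu.add hv), ?_⟩
  rw [← hq] at hua hvb ⊢
  exact (map_add_le_add q u v).trans (add_le_add hua hvb)

theorem const_mul (hf : HasEnergyLE 𝓔 f a) (c : ℝ) :
    HasEnergyLE 𝓔 (fun x => c * f x) (|c| * a) := by
  obtain ⟨q, hq⟩ := 𝓔.isPEnergy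
  obtain ⟨u, hu, hua⟩ := hf
  refine ⟨c • u, (Lp.coeFn_smul c u.1).trans ?_, ?_⟩
  · filter_upwards [hu] with x hx
    simp [hx]
  · rw [← hq] at hua ⊢
    rw [map_smul_eq_mul, Real.norm_eq_abs]
    gcongr

theorem sub (hf : HasEnergyLE 𝓔 f a) (hg : HasEnergyLE 𝓔 g b) :
    HasEnergyLE 𝓔 (fun x => f x - g x) (a + b) := by
  have := hf.add (hg.const_mul (-1))
  simp only [abs_neg, abs_one, one_mul, neg_mul] at this
  simpa only [sub_eq_add_neg] using this

theorem comp_lipschitz (hf : HasEnergyLE 𝓔 f a) (φ : ℝ → ℝ) (hφ : LipschitzWith 1 φ)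
    (h0 : φ 0 = 0) : HasEnergyLE 𝓔 (fun x => φ (f x)) a := by
  obtain ⟨u, hu, hua⟩ := hf
  obtain ⟨h, hE⟩ := 𝓔.lipschitz_contraction u φ hφ h0
  refine ⟨⟨_, h⟩, (hφ.coeFn_compLp h0 u.1).trans ?_, le_trans ?_ hua⟩
  · filter_upwards [hu] with x hx
    simp [hx]
  · have := one_lt_exponent p
    gcongr

theorem posPart (hf : HasEnergyLE 𝓔 f a) : HasEnergyLE 𝓔 (fun x => max (f x) 0) a :=
  hf.comp_lipschitz (fun t => max t 0) (LipschitzWith.id.max_const 0) (by simp)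

theorem abs (hf : HasEnergyLE 𝓔 f a) : HasEnergyLE 𝓔 (fun x => |f x|) a :=
  hf.comp_lipschitz (fun t => |t|) lipschitzWith_one_norm (by simp)

theorem clamp (hf : HasEnergyLE 𝓔 f a) {N : ℝ} (hN : 0 ≤ N) :
    HasEnergyLE 𝓔 (fun x => min (max (f x) 0) N) a :=
  hf.comp_lipschitz (fun t => min (max t 0) N)
    ((LipschitzWith.id.max_const 0).min_const N) (by simpa using hN)

theorem max (hf : HasEnergyLE 𝓔 f a) (hg : HasEnergyLE 𝓔 g b) :
    HasEnergyLE 𝓔 (fun x => max (f x) (g x)) (a + b) := by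
  -- max(f, g) = (f + g + |f - g|) / 2, and the absolute value is a 1-Lipschitz map.
  have h := ((hf.add hg).add (hf.sub hg).abs).const_mul (1 / 2)
  rw [abs_of_pos (by norm_num : (0 : ℝ) < 1 / 2)] at h
  refine (h.mono (by linarith)).congr (Eventually.of_forall fun x => ?_)
  simp only [max_def, abs_eq_max_neg]
  split_ifs <;> linarith

theorem sum {ι : Type*} (s : Finset ι) {f : ι → X → ℝ} {a : ι → ℝ}
    (h : ∀ i ∈ s, HasEnergyLE 𝓔 (f i) (a i)) :
    HasEnergyLE 𝓔 (fun x => ∑ i ∈ s, f i x) (∑ i ∈ s, a i) := by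
  classical
  induction s using Finset.induction_on with
  | empty => simpa using zero
  | insert i s hi ih =>
    simp only [Finset.sum_insert hi]
    exact (h i (by simp)).add (ih fun j hj => h j (by simp [hj]))

end HasEnergyLE

/-- The `L^p` limit of a sequence with bounded energies, taken from a subspace `S` of the domain,
belongs to the closure of `S` in the domain. -/
theorem exists_mem_closure_of_tendsto (𝓔 : EnergyStructure m p)
    (S : Submodule ℝ 𝓔.toPEnergyForm.Domain) (v : ℕ → 𝓔.toPEnergyForm.Domain) (hv : ∀ n, v n ∈ S)
    (M : ℝ) (hM : ∀ n, (𝓔.E (v n) : ℝ) ^ (1 / p) ≤ M) (w : Lp ℝ (ENNReal.ofReal p) m)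
    (hw : Tendsto (fun n => domainInclusion _ (v n)) atTop (𝓝 w)) :
    ∃ x ∈ closure (S : Set 𝓔.toPEnergyForm.Domain), domainInclusion _ x = w := by
  obtain ⟨K, hK⟩ := (Metric.isBounded_range_of_tendsto _ hw).exists_norm_le
  refine 𝓔.reflexive.exists_mem_closure _ S v hv (K + M) (fun n => ?_) w hw
  exact add_le_add (hK _ ⟨n, rfl⟩) (hM n)

end Energy

/-! ### Strong locality on the whole domain -/

theorem isCcVersion_zero {X : Type*} [MetricSpace X] [MeasurableSpace X] {m : Measure X}
    (q : ℝ≥0∞) : IsCcVersion (0 : Lp ℝ q m) (fun _ : X => (0 : ℝ)) :=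
  ⟨continuous_const, HasCompactSupport.zero, Lp.coeFn_zero _ _ _⟩

section Locality

variable {X : Type*} [MetricSpace X] [MeasurableSpace X] [BorelSpace X] {m : Measure X} {p : ℝ}
  [Fact (1 < p)]

/-- The seminorm `u ↦ Γ⟨u⟩(A)^{1/p}`. -/
def localSeminorm (𝓔 : EnergyStructure m p) {A : Set X} (hA : MeasurableSet A) : Seminorm ℝ 𝓔.F :=
  (𝓔.measure_isPEnergy A hA).choose

theorem localSeminorm_apply (𝓔 : EnergyStructure m p) {A : Set X} (hA : MeasurableSet A)
    (u : 𝓔.F) : localSeminorm 𝓔 hA u = (𝓔.Γ u A : ℝ) ^ (1 / p) :=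
  (𝓔.measure_isPEnergy A hA).choose_spec u

theorem localSeminorm_le_energy (𝓔 : EnergyStructure m p) {A : Set X} (hA : MeasurableSet A)
    (u : 𝓔.F) : localSeminorm 𝓔 hA u ≤ (𝓔.E u : ℝ) ^ (1 / p) := by
  have hp := one_lt_exponent p
  rw [localSeminorm_apply, 𝓔.measure_univ]
  have : 𝓔.Γ u A ≤ 𝓔.Γ u univ := (𝓔.Γ u).apply_mono (subset_univ A)
  gcongr

theorem localSeminorm_eq_zero_iff (𝓔 : EnergyStructure m p) {A : Set X} (hA : MeasurableSet A)
    (u : 𝓔.F) : localSeminorm 𝓔 hA u = 0 ↔ (𝓔.Γ u : Measure X) A = 0 := by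
  have hp := one_lt_exponent p
  rw [localSeminorm_apply, Real.rpow_eq_zero (NNReal.coe_nonneg _) (by positivity),
    NNReal.coe_eq_zero, FiniteMeasure.null_iff_toMeasure_null]

theorem energyMeasure_zero (𝓔 : EnergyStructure m p) {A : Set X} (hA : MeasurableSet A) :
    (𝓔.Γ 0 : Measure X) A = 0 := by
  rw [← localSeminorm_eq_zero_iff 𝓔 hA, map_zero]

/-- The local seminorm is dominated by the domain norm, hence continuous, so its null space is
closed. -/
theorem localSeminorm_eq_zero_of_mem_closure (𝓔 : EnergyStructure m p) {A : Set X}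
    (hA : MeasurableSet A) (S : Set 𝓔.toPEnergyForm.Domain)
    (hS : ∀ v ∈ S, localSeminorm 𝓔 hA v = 0) (u : 𝓔.toPEnergyForm.Domain) (hu : u ∈ closure S) :
    localSeminorm 𝓔 hA u = 0 := by
  refine le_antisymm (le_of_forall_pos_le_add fun ε hε => ?_) (apply_nonneg _ _)
  obtain ⟨v, hv, hd⟩ := Metric.mem_closure_iff.1 hu ε hε
  rw [dist_eq_norm] at hd
  have h1 : localSeminorm 𝓔 hA (u - v) ≤ ‖u - v‖ :=
    (localSeminorm_le_energy 𝓔 hA (u - v)).trans (le_add_of_nonneg_left (norm_nonneg _))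
  have h2 : localSeminorm 𝓔 hA u ≤ localSeminorm 𝓔 hA (u - v) + localSeminorm 𝓔 hA v := by
    have := map_add_le_add (localSeminorm 𝓔 hA) (u - v) v
    have e : u - v + v = u := sub_add_cancel u v
    exact (congrArg _ e).symm.le.trans this
  rw [hS v hv] at h2
  linarith

/-- The functions of the domain with a version in `C_c(X)` that vanishes on `K`. -/
def vanishingSubmodule (𝓔 : EnergyStructure m p) (K : Set X) :
    Submodule ℝ 𝓔.toPEnergyForm.Domain where
  carrier := {v | ∃ f, IsCcVersion (domainInclusion _ v) f ∧ ∀ x ∈ K, f x = 0}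
  zero_mem' := ⟨fun _ => 0, isCcVersion_zero _, fun _ _ => rfl⟩
  add_mem' := by
    rintro u v ⟨f, ⟨hf1, hf2, hf3⟩, hf⟩ ⟨g, ⟨hg1, hg2, hg3⟩, hg⟩
    refine ⟨f + g, ⟨hf1.add hg1, hf2.add hg2, ?_⟩, fun x hx => by simp [hf x hx, hg x hx]⟩
    rw [map_add]
    exact (Lp.coeFn_add _ _).trans (hf3.add hg3)
  smul_mem' := by
    rintro c u ⟨f, ⟨hf1, hf2, hf3⟩, hf⟩
    refine ⟨fun x => c * f x, ⟨continuous_const.mul hf1, hf2.mul_left, ?_⟩,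
      fun x hx => by simp [hf x hx]⟩
    rw [map_smul]
    refine (Lp.coeFn_smul _ _).trans ?_
    filter_upwards [hf3] with x hx
    simp [hx]

theorem localSeminorm_of_mem_vanishingSubmodule (𝓔 : EnergyStructure m p) {K : Set X}
    (v : 𝓔.toPEnergyForm.Domain) (hv : v ∈ vanishingSubmodule 𝓔 K) :
    localSeminorm 𝓔 isOpen_interior.measurableSet (A := interior K) v = 0 := by
  obtain ⟨f, hf, hK⟩ := hv
  refine (localSeminorm_eq_zero_iff 𝓔 _ _).2 ?_
  have h := 𝓔.strongly_local v 0 f (fun _ => 0) hf (isCcVersion_zero _) (interior K)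
    isOpen_interior ⟨0, fun x hx => by simp [hK x (interior_subset hx)]⟩
  have h2 := congrArg (fun μ : Measure X => μ univ) h
  simp only [Measure.restrict_apply_univ] at h2
  rw [h2]
  exact energyMeasure_zero 𝓔 isOpen_interior.measurableSet

/-- Cutoff functions in `F ∩ C_c(X)`. -/
theorem exists_cutoff [LocallyCompactSpace X] (𝓔 : EnergyStructure m p) {K U : Set X}
    (hK : IsCompact K) (hU : IsOpen U) (hKU : K ⊆ U) :
    ∃ (χ : X → ℝ) (c : ℝ), HasEnergyLE 𝓔 χ c ∧ Continuous χ ∧ HasCompactSupport χ ∧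
      (∀ x, 0 ≤ χ x ∧ χ x ≤ 1) ∧ (∀ x ∈ K, χ x = 1) ∧ ∀ x ∉ U, χ x = 0 := by
  obtain ⟨f, hf1, hf0, hfc, -⟩ := exists_continuous_one_zero_of_isCompact hK hU.isClosed_compl
    (disjoint_compl_right_iff_subset.2 hKU)
  -- With 3f approximated to within 1, g exceeds 2 on K and is below 1 off U. Clamping g - 1 to [0,
  -- 1] then gives exactly 1 and exactly 0.
  obtain ⟨v, g, ⟨hg1, hg2, hg3⟩, hg⟩ := 𝓔.dense_Cc (fun x => 3 * f x) (by fun_prop) hfc.mul_left 1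
    one_pos
  let φ : ℝ → ℝ := fun t => min (max (t - 1) 0) 1
  have hφ : LipschitzWith 1 φ :=
    (((LipschitzWith.id.sub (LipschitzWith.const 1)).weaken (by simp)).max_const 0).min_const 1
  have hφ0 : φ 0 = 0 := by simp [φ]
  have hgE : HasEnergyLE 𝓔 g ((𝓔.E v : ℝ) ^ (1 / p)) := ⟨v, hg3, le_rfl⟩
  refine ⟨fun x => φ (g x), _, hgE.comp_lipschitz φ hφ hφ0, hφ.continuous.comp hg1,
    hg2.comp_left hφ0, fun x => ?_, fun x hx => ?_, fun x hx => ?_⟩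
  · exact ⟨le_min (le_max_right _ _) zero_le_one, min_le_right _ _⟩
  · have h1 := hg x
    rw [hf1 hx, Pi.one_apply, abs_lt] at h1
    exact min_eq_right (le_max_of_le_left (by linarith))
  · have h1 := hg x
    rw [hf0 hx, Pi.zero_apply, abs_lt] at h1
    have : max (g x - 1) 0 = 0 := max_eq_right (by linarith)
    simp [φ, this]

/-- The function is an L^p limit, with bounded energies, of members of `vanishingSubmodule`. Weak
compactness places it in the norm closure of that subspace, on which the local seminorm vanishes.
The energies of the approximants are only bounded, so their strong convergence in the domain is not
needed. -/
theorem localSeminorm_eq_zero_of_nonneg [LocallyCompactSpace X] (𝓔 : EnergyStructure m p)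
    (u : 𝓔.F) {N : ℝ} (hN : 0 ≤ N) (huN : ∀ᵐ x ∂m, 0 ≤ u.1 x ∧ u.1 x ≤ N) {K U : Set X}
    (hK : IsCompact K) (hU : IsOpen U) (hKU : K ⊆ U) (hu : ∀ᵐ x ∂m, x ∈ U → u.1 x = 0) :
    localSeminorm 𝓔 isOpen_interior.measurableSet (A := interior K) u = 0 := by
  obtain ⟨χ, c, hχ, hχc, hχs, hχ01, hχ1, hχ0⟩ := exists_cutoff 𝓔 hK hU hKU
  have hpos : ∀ n : ℕ, (0 : ℝ) < 1 / (n + 1) := fun n => Nat.one_div_pos_of_nat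
  choose w g hg hd using fun n : ℕ => 𝓔.dense_domain u (1 / (n + 1)) (hpos n)
  obtain ⟨q, hq⟩ := 𝓔.isPEnergy
  have hwE : ∀ n, (𝓔.E (w n) : ℝ) ^ (1 / p) ≤ (𝓔.E u : ℝ) ^ (1 / p) + 1 := by
    intro n
    have h1 : (𝓔.E (u - w n) : ℝ) ^ (1 / p) ≤ 1 := by
      refine (le_add_of_nonneg_left (norm_nonneg _)).trans ((hd n).le.trans ?_)
      rw [div_le_one (by positivity)]
      linarith [(Nat.cast_nonneg n : (0 : ℝ) ≤ n)]
    rw [← hq] at h1 ⊢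
    rw [← hq]
    have h2 := map_sub_le_add q u (u - w n)
    rw [sub_sub_cancel] at h2
    linarith
  -- Subtracting N χ after clamping to [0, N] forces the value 0 on K, where χ = 1, and leaves
  -- clamped values unchanged off U, where χ = 0.
  have hL : ∀ n, HasEnergyLE 𝓔 (fun x => max (min (max (g n x) 0) N - N * χ x) 0)
      ((𝓔.E u : ℝ) ^ (1 / p) + 1 + |N| * c) := fun n =>
    ((HasEnergyLE.clamp ⟨w n, (hg n).2.2, hwE n⟩ hN).sub (hχ.const_mul N)).posPart
  choose v hv hvE using hL
  have hvS : ∀ n, v n ∈ vanishingSubmodule 𝓔 K := by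
    intro n
    refine ⟨_, ⟨?_, ?_, hv n⟩, fun x hx => ?_⟩
    · have := (hg n).1
      fun_prop
    · refine HasCompactSupport.intro ((hg n).2.1.isCompact.union hχs.isCompact) fun x hx => ?_
      rw [mem_union, not_or] at hx
      simp [image_eq_zero_of_notMem_tsupport hx.1, image_eq_zero_of_notMem_tsupport hx.2, hN]
    · rw [hχ1 x hx]
      simp
  have hlim : Tendsto (fun n => domainInclusion 𝓔.toPEnergyForm (v n)) atTop (𝓝 u.1) := by
    rw [tendsto_iff_norm_sub_tendsto_zero]
    refine squeeze_zero (fun n => norm_nonneg _) (fun n => ?_)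
      tendsto_one_div_add_atTop_nhds_zero_nat
    refine le_trans (b := ‖(u - w n).1‖) ?_
      ((le_add_of_nonneg_right (energy_nonneg _ _)).trans (hd n).le)
    refine Lp.norm_le_norm_of_ae_le ?_
    have e : (u - w n).1 = u.1 - (w n).1 := rfl
    rw [e]
    filter_upwards [Lp.coeFn_sub (domainInclusion 𝓔.toPEnergyForm (v n)) u.1,
      Lp.coeFn_sub u.1 (w n).1, hv n, (hg n).2.2, hu, huN] with x h1 h2 h3 h4 h5 h6
    have h3' : domainInclusion 𝓔.toPEnergyForm (v n) x
      = max (min (max (g n x) 0) N - N * χ x) 0 := h3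
    rw [h1, h2, Pi.sub_apply, Pi.sub_apply, h3', h4]
    -- The truncation used for `v n` fixes u: on U both sides are 0, off U the cutoff is 0. As the
    -- truncation is 1-Lipschitz in the value, |v_n - u| ≤ |g_n - u|.
    have h7 : u.1 x = max (min (max (u.1 x) 0) N - N * χ x) 0 := by
      by_cases hx : x ∈ U
      · rw [h5 hx]
        have := mul_nonneg hN (hχ01 x).1
        simp [hN, this]
      · rw [hχ0 x hx]
        simp [h6.1, h6.2]
    rw [norm_sub_rev]
    conv_lhs => rw [h7]
    simp only [Real.norm_eq_abs]
    refine (abs_max_sub_max_le_abs _ _ _).trans ?_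
    rw [sub_sub_sub_cancel_right]
    refine (abs_min_sub_min_le_max _ _ _ _).trans ?_
    rw [sub_self, abs_zero]
    exact max_le (abs_max_sub_max_le_abs _ _ _) (abs_nonneg _)
  obtain ⟨x, hx, hxu⟩ := exists_mem_closure_of_tendsto 𝓔 _ v hvS _ hvE u.1 hlim
  have hxu' : x = u := Subtype.ext hxu
  rw [← hxu']
  exact localSeminorm_eq_zero_of_mem_closure 𝓔 _ _
    (fun v hv => localSeminorm_of_mem_vanishingSubmodule 𝓔 v hv) x hx

theorem localSeminorm_eq_zero_of_bounded [LocallyCompactSpace X] (𝓔 : EnergyStructure m p)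
    (u : 𝓔.F) {N : ℝ} (hN : 0 ≤ N) (huN : ∀ᵐ x ∂m, |u.1 x| ≤ N) {K U : Set X}
    (hK : IsCompact K) (hU : IsOpen U) (hKU : K ⊆ U) (hu : ∀ᵐ x ∂m, x ∈ U → u.1 x = 0) :
    localSeminorm 𝓔 isOpen_interior.measurableSet (A := interior K) u = 0 := by
  have hL : HasEnergyLE 𝓔 u.1 ((𝓔.E u : ℝ) ^ (1 / p)) := ⟨u, EventuallyEq.rfl, le_rfl⟩
  obtain ⟨a, ha, -⟩ := hL.posPart
  obtain ⟨b, hb, -⟩ := (hL.const_mul (-1)).posPart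
  have hab : u = a - b := by
    refine Subtype.ext (Lp.ext ?_)
    have e : (a - b).1 = a.1 - b.1 := rfl
    rw [e]
    filter_upwards [Lp.coeFn_sub a.1 b.1, ha, hb] with x h1 h2 h3
    rw [h1, Pi.sub_apply, h2, h3]
    rcases le_total (u.1 x) 0 with h | h
    · simp [h]
    · simp [h]
  have ha0 := localSeminorm_eq_zero_of_nonneg 𝓔 a hN (by
    filter_upwards [ha, huN] with x h1 h2
    rw [h1]
    exact ⟨le_max_right _ _, max_le ((le_abs_self _).trans h2) hN⟩) hK hU hKU (by
    filter_upwards [ha, hu] with x h1 h2 hx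
    rw [h1, h2 hx, max_self])
  have hb0 := localSeminorm_eq_zero_of_nonneg 𝓔 b hN (by
    filter_upwards [hb, huN] with x h1 h2
    rw [h1]
    exact ⟨le_max_right _ _, max_le (by linarith [neg_abs_le (u.1 x)]) hN⟩) hK hU hKU (by
    filter_upwards [hb, hu] with x h1 h2 hx
    rw [h1, h2 hx, mul_zero, max_self])
  refine le_antisymm ?_ (apply_nonneg _ _)
  rw [hab]
  refine (map_sub_le_add _ a b).trans ?_
  rw [ha0, hb0, add_zero]

/-- The energy measure of a bounded function of the domain vanishes on open sets on which the
function is constant. -/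
theorem energyMeasure_eq_zero_of_const [LocallyCompactSpace X] [SecondCountableTopology X]
    (𝓔 : EnergyStructure m p) (u : 𝓔.F) {N : ℝ} (huN : ∀ᵐ x ∂m, |u.1 x| ≤ N) {U : Set X}
    (hU : IsOpen U) {c : ℝ} (hu : ∀ᵐ x ∂m, x ∈ U → u.1 x = c) :
    (𝓔.Γ u : Measure X) U = 0 := by
  refine measure_null_of_locally_null _ fun x hx => ?_
  obtain ⟨K, hK, hxK, hKU⟩ := exists_compact_subset hU hx
  -- Two nested compact sets: the cutoff is 1 on K, so u - cχ vanishes a.e. on the interior of K, an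
  -- open neighbourhood of K'. Both u - cχ and χ then have no energy in the interior of K'.
  obtain ⟨K', hK', hxK', hKK'⟩ := exists_compact_subset isOpen_interior hxK
  obtain ⟨χ, e, ⟨v, hv, -⟩, hχc, hχs, hχ01, hχ1, -⟩ := exists_cutoff 𝓔 hK hU hKU
  have hN : ∀ᵐ x ∂m, |(u - c • v).1 x| ≤ |N| + |c| := by
    have e : (u - c • v).1 = u.1 - c • v.1 := rfl
    rw [e]
    filter_upwards [Lp.coeFn_sub u.1 (c • v.1), Lp.coeFn_smul c v.1, hv, huN] with x h1 h2 h3 h4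
    rw [h1, Pi.sub_apply, h2, Pi.smul_apply, h3, smul_eq_mul]
    refine (abs_sub _ _).trans (add_le_add (h4.trans (le_abs_self _)) ?_)
    rw [abs_mul, abs_of_nonneg (hχ01 x).1]
    exact mul_le_of_le_one_right (abs_nonneg _) (hχ01 x).2
  have h1 := localSeminorm_eq_zero_of_bounded 𝓔 (u - c • v) (by positivity) hN hK'
    isOpen_interior hKK' (by
      have e : (u - c • v).1 = u.1 - c • v.1 := rfl
      rw [e]
      filter_upwards [Lp.coeFn_sub u.1 (c • v.1), Lp.coeFn_smul c v.1, hv, hu] with x h1 h2 h3 h4 hx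
      rw [h1, Pi.sub_apply, h2, Pi.smul_apply, h3, smul_eq_mul, h4 (hKU (interior_subset hx)),
        hχ1 x (interior_subset hx), mul_one, sub_self])
  have h2 : localSeminorm 𝓔 isOpen_interior.measurableSet (A := interior K') v = 0 := by
    rw [localSeminorm_eq_zero_iff]
    have h := 𝓔.strongly_local v 0 χ (fun _ => 0) ⟨hχc, hχs, hv⟩ (isCcVersion_zero _) (interior K')
      isOpen_interior ⟨1, fun x hx => by
        simp [hχ1 x (interior_subset (hKK' (interior_subset hx)))]⟩
    have h2 := congrArg (fun μ : Measure X => μ univ) h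
    simp only [Measure.restrict_apply_univ] at h2
    rw [h2]
    exact energyMeasure_zero 𝓔 isOpen_interior.measurableSet
  refine ⟨interior K', mem_nhdsWithin_of_mem_nhds (isOpen_interior.mem_nhds hxK'), ?_⟩
  rw [← localSeminorm_eq_zero_iff 𝓔 isOpen_interior.measurableSet]
  refine le_antisymm ?_ (apply_nonneg _ _)
  have h3 := map_add_le_add (localSeminorm 𝓔 isOpen_interior.measurableSet (A := interior K'))
    (u - c • v) (c • v)
  rw [sub_add_cancel, map_smul_eq_mul, h1, h2, mul_zero, add_zero] at h3
  exact h3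

end Locality

/-! ### Doubling measures and nets -/

/-- A maximal `s`-separated set. -/
structure IsNet {X : Type*} [MetricSpace X] (s : ℝ) (N : Set X) : Prop where
  countable : N.Countable
  separated : N.Pairwise fun x y => s ≤ dist x y
  cover : ∀ x, ∃ y ∈ N, dist x y < s

/-- A set that is maximal among s-separated ones covers, since an uncovered point could be added. It
is countable because the balls of radius s/2 around it are disjoint open sets in a separable space.
-/
theorem exists_isNet {X : Type*} [MetricSpace X] [TopologicalSpace.SeparableSpace X] {s : ℝ}
    (hs : 0 < s) :
    ∃ N : Set X, IsNet s N := by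
  obtain ⟨N, hN⟩ := zorn_subset {N : Set X | N.Pairwise fun x y => s ≤ dist x y} (by
    intro c hc hchain
    refine ⟨⋃₀ c, ?_, fun t ht => subset_sUnion_of_mem ht⟩
    exact (pairwise_sUnion hchain.directedOn).2 hc)
  refine ⟨N, ?_, hN.prop, fun x => ?_⟩
  · refine Set.PairwiseDisjoint.countable_of_isOpen (s := fun x => Metric.ball x (s / 2)) ?_
      (fun x _ => Metric.isOpen_ball) (fun x _ => ⟨x, Metric.mem_ball_self (by linarith)⟩)
    intro x hx y hy hxy
    refine Metric.ball_disjoint_ball ?_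
    have := hN.prop hx hy hxy
    simp only at this
    linarith
  · by_contra! h
    have hx : x ∈ N := by
      refine hN.le_of_ge (y := insert x N) ?_ (subset_insert x N) (mem_insert x N)
      exact hN.prop.insert fun y hy _ => ⟨h y hy, by rw [dist_comm]; exact h y hy⟩
    have := h x hx
    rw [dist_self] at this
    linarith

section Doubling

variable {X : Type*} [MetricSpace X] [MeasurableSpace X] {m : Measure X}

theorem VolumeDoubling.exists_ball_le (hVD : VolumeDoubling m) (Λ : ℝ) :
    ∃ C : ℝ≥0, 0 < C ∧ ∀ (x y : X) (r R : ℝ), 0 < r → dist x y + R ≤ Λ * r →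
      m (Metric.ball x R) ≤ C * m (Metric.ball y r) := by
  obtain ⟨c, hc1, hc⟩ := hVD
  obtain ⟨n, hn⟩ := pow_unbounded_of_one_lt Λ (one_lt_two : (1 : ℝ) < 2)
  have key : ∀ (k : ℕ) (y : X) (r : ℝ), 0 < r →
      m (Metric.ball y (2 ^ k * r)) ≤ (c ^ k : ℝ≥0) * m (Metric.ball y r) := by
    intro k
    induction k with
    | zero => intro y r _; simp
    | succ k ih =>
      intro y r hr
      have h := hc y (2 ^ k * r) (by positivity)
      rw [← mul_assoc, ← pow_succ'] at h
      refine h.trans ((mul_le_mul_right (ih y r hr) _).trans_eq ?_)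
      rw [← mul_assoc, ← ENNReal.coe_mul, ← pow_succ']
  refine ⟨c ^ n, pow_pos (one_pos.trans_le hc1) n, fun x y r R hr h => ?_⟩
  refine le_trans (measure_mono (Metric.ball_subset_ball' ?_)) (key n y r hr)
  have : Λ * r ≤ 2 ^ n * r := by gcongr
  linarith

theorem VolumeDoubling.ball_lt_top [IsLocallyFiniteMeasure m] (hVD : VolumeDoubling m) (x : X)
    (r : ℝ) : m (Metric.ball x r) < ∞ := by
  obtain ⟨t, ht, hlt⟩ := m.finiteAt_nhds x
  obtain ⟨ε, hε, hfin⟩ := Metric.nhds_basis_ball.mem_iff.1 ht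
  obtain ⟨C, -, hC⟩ := hVD.exists_ball_le (r / ε)
  refine (hC x x ε r hε ?_).trans_lt (ENNReal.mul_lt_top ENNReal.coe_lt_top
    ((measure_mono hfin).trans_lt hlt))
  rw [dist_self, zero_add, div_mul_cancel₀ _ hε.ne']

/-- Bounded overlap: the number of points of an `s`-separated set in a ball of radius `Λ s` is
bounded. -/
theorem VolumeDoubling.exists_card_le [BorelSpace X] [IsLocallyFiniteMeasure m]
    [m.IsOpenPosMeasure] (hVD : VolumeDoubling m) (Λ : ℝ) :
    ∃ n : ℕ, ∀ (s : ℝ) (N : Set X), 0 < s → IsNet s N → ∀ (x : X) (T : Finset N),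
      (∀ i ∈ T, dist x i < Λ * s) → T.card ≤ n := by
  -- The disjoint balls of radius s/2 around the points of `T` lie in B(x, (|Λ|+1)s), and each
  -- carries at least 1/C of its measure. The constant is |Λ| + (|Λ|+1) counted in units of s/2.
  obtain ⟨C, hC0, hC⟩ := hVD.exists_ball_le (2 * (2 * |Λ| + 1))
  refine ⟨⌈C⌉₊, fun s N hs hN x T hT => ?_⟩
  have hpos : 0 < m (Metric.ball x ((|Λ| + 1) * s)) := Metric.measure_ball_pos m x (by positivity)
  have hfin := hVD.ball_lt_top x ((|Λ| + 1) * s)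
  have hΛ : Λ * s ≤ |Λ| * s := by gcongr; exact le_abs_self Λ
  have h1 : ∀ i ∈ T, m (Metric.ball x ((|Λ| + 1) * s)) ≤ C * m (Metric.ball (i : X) (s / 2)) := by
    intro i hi
    refine hC _ _ _ _ (by linarith) ?_
    have := hT i hi
    nlinarith
  have h2 : ∑ i ∈ T, m (Metric.ball (i : X) (s / 2)) ≤ m (Metric.ball x ((|Λ| + 1) * s)) := by
    rw [← measure_biUnion_finset]
    · refine measure_mono (iUnion₂_subset fun i hi => Metric.ball_subset_ball' ?_)
      have := hT i hi
      rw [dist_comm] at this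
      linarith
    · intro i _ j _ hij
      refine Metric.ball_disjoint_ball ?_
      have := hN.separated i.2 j.2 (fun h => hij (Subtype.ext h))
      simp only at this
      linarith
    · exact fun i _ => Metric.isOpen_ball.measurableSet
  have h3 : (T.card : ℝ≥0∞) * m (Metric.ball x ((|Λ| + 1) * s))
      ≤ C * m (Metric.ball x ((|Λ| + 1) * s)) := by
    calc (T.card : ℝ≥0∞) * m (Metric.ball x ((|Λ| + 1) * s))
        = ∑ i ∈ T, m (Metric.ball x ((|Λ| + 1) * s)) := by simp
      _ ≤ ∑ i ∈ T, C * m (Metric.ball (i : X) (s / 2)) := Finset.sum_le_sum h1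
      _ ≤ _ := by rw [← Finset.mul_sum]; gcongr
  rw [ENNReal.mul_le_mul_iff_left hpos.ne' hfin.ne] at h3
  have h4 : (T.card : ℝ≥0) ≤ C := by exact_mod_cast h3
  exact_mod_cast h4.trans (Nat.le_ceil C)

theorem tsum_lintegral_ball_le [BorelSpace X] {s Λ : ℝ} {N : Set X} (hN : IsNet s N) {n : ℕ}
    (hn : ∀ (x : X) (T : Finset N), (∀ i ∈ T, dist x i < Λ * s) → T.card ≤ n) (μ : Measure X)
    {g : X → ℝ≥0∞} (hg : AEMeasurable g μ) :
    ∑' i : N, ∫⁻ x in Metric.ball (i : X) (Λ * s), g x ∂μ ≤ n * ∫⁻ x, g x ∂μ := by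
  have := hN.countable.to_subtype
  simp only [← lintegral_indicator Metric.isOpen_ball.measurableSet]
  rw [← lintegral_tsum fun i => hg.indicator Metric.isOpen_ball.measurableSet,
    ← lintegral_const_mul' _ _ (ENNReal.natCast_ne_top n)]
  refine lintegral_mono fun x => ?_
  classical
  rw [ENNReal.tsum_eq_iSup_sum]
  refine iSup_le fun T => ?_
  simp only [indicator_apply, ← Finset.sum_filter, Finset.sum_const, nsmul_eq_mul]
  gcongr
  exact hn x _ fun i hi => (Finset.mem_filter.1 hi).2

theorem tsum_measure_ball_le [BorelSpace X] {s Λ : ℝ} {N : Set X} (hN : IsNet s N) {n : ℕ}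
    (hn : ∀ (x : X) (T : Finset N), (∀ i ∈ T, dist x i < Λ * s) → T.card ≤ n) (μ : Measure X) :
    ∑' i : N, μ (Metric.ball (i : X) (Λ * s)) ≤ n * μ univ := by
  simpa using tsum_lintegral_ball_le hN hn μ (g := fun _ => 1) aemeasurable_const

theorem lintegral_le_tsum_ball {s : ℝ} {N : Set X} (hN : IsNet s N) (μ : Measure X)
    (g : X → ℝ≥0∞) :
    ∫⁻ x, g x ∂μ ≤ ∑' i : N, ∫⁻ x in Metric.ball (i : X) s, g x ∂μ := by
  have := hN.countable.to_subtype
  have h : (⋃ i : N, Metric.ball (i : X) s) = univ := by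
    refine eq_univ_of_forall fun x => ?_
    obtain ⟨y, hy, hxy⟩ := hN.cover x
    exact mem_iUnion.2 ⟨⟨y, hy⟩, hxy⟩
  calc ∫⁻ x, g x ∂μ = ∫⁻ x in ⋃ i : N, Metric.ball (i : X) s, g x ∂μ := by
        rw [h, Measure.restrict_univ]
    _ ≤ _ := lintegral_iUnion_le _ _

end Doubling

/-! ### The upper bound for the Besov functionals -/

theorem ofReal_abs_sub_rpow_le {p : ℝ} (hp : 0 ≤ p) (a b c : ℝ) :
    ENNReal.ofReal (|a - b| ^ p) ≤
      ENNReal.ofReal (2 ^ p) * (ENNReal.ofReal (|a - c| ^ p) + ENNReal.ofReal (|b - c| ^ p)) := by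
  rw [← ENNReal.ofReal_add (by positivity) (by positivity), ← ENNReal.ofReal_mul (by positivity)]
  refine ENNReal.ofReal_le_ofReal ?_
  have h1 : |a - b| ≤ 2 * max |a - c| |b - c| := by
    have := abs_sub_le a c b
    rw [abs_sub_comm c b] at this
    linarith [le_max_left |a - c| |b - c|, le_max_right |a - c| |b - c|]
  calc |a - b| ^ p ≤ (2 * max |a - c| |b - c|) ^ p := by gcongr
    _ = 2 ^ p * (max |a - c| |b - c|) ^ p := Real.mul_rpow (by norm_num) (by positivity)
    _ ≤ _ := by
      gcongr
      have h2 : 0 ≤ |a - c| ^ p := by positivity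
      have h3 : 0 ≤ |b - c| ^ p := by positivity
      rcases max_choice |a - c| |b - c| with h | h <;> rw [h] <;> linarith

namespace IsScaleFunction

variable {Ψ : ℝ → ℝ}

theorem pos (hΨ : IsScaleFunction Ψ) {r : ℝ} (hr : 0 < r) : 0 < Ψ r := hΨ.bijOn.mapsTo hr

theorem mono (hΨ : IsScaleFunction Ψ) {r R : ℝ} (hr : 0 < r) (h : r ≤ R) : Ψ r ≤ Ψ R :=
  hΨ.strictMonoOn.monotoneOn hr (hr.trans_le h) h

theorem exists_le_mul (hΨ : IsScaleFunction Ψ) {Λ : ℝ} (hΛ : 1 ≤ Λ) :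
    ∃ C : ℝ, 0 < C ∧ ∀ r, 0 < r → Ψ (Λ * r) ≤ C * Ψ r := by
  obtain ⟨C, β₁, β₂, hC, -, -, h⟩ := hΨ.ratio_bounds
  refine ⟨C * Λ ^ β₂, by positivity, fun r hr => ?_⟩
  have := (h r (Λ * r) hr (by nlinarith)).2
  rwa [mul_div_assoc, div_self hr.ne', mul_one, div_le_iff₀ (hΨ.pos hr)] at this

/-- Ψ is unrestricted outside (0, ∞), so only its cut-off version is known to be measurable. -/
theorem measurable_indicator (hΨ : IsScaleFunction Ψ) : Measurable ((Ioi 0).indicator Ψ) := by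
  classical
  rw [← piecewise_eq_indicator]
  exact hΨ.continuousOn.measurable_piecewise continuousOn_const measurableSet_Ioi

end IsScaleFunction

/-- The kernel `1_{B(y, r)}(x) / m(B(y, r))`. -/
def ballKernel {X : Type*} [MetricSpace X] [MeasurableSpace X] (m : Measure X) (r : ℝ) (x y : X) :
    ℝ≥0∞ :=
  (Metric.ball y r).indicator (fun _ => 1) x / m (Metric.ball y r)

/-- The functional `∫∫_{d(x, y) < r} |u(x) - u(y)|^p / m(B(y, r)) m(dx) m(dy)`. -/
def ballFunctional {X : Type*} [MetricSpace X] [MeasurableSpace X] (m : Measure X) (p r : ℝ)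
    (u : X → ℝ) : ℝ≥0∞ :=
  ∫⁻ y, ∫⁻ x, ENNReal.ofReal (|u x - u y| ^ p) * ballKernel m r x y ∂m ∂m

theorem measurable_difference {X : Type*} [MeasurableSpace X] {p : ℝ} {u : X → ℝ}
    (hu : Measurable u) :
    Measurable fun z : X × X => ENNReal.ofReal (|u z.2 - u z.1| ^ p) := by
  fun_prop

section Upper

variable {X : Type*} [MetricSpace X] [MeasurableSpace X] [BorelSpace X] {m : Measure X}

theorem measurable_ballKernel [SecondCountableTopology X] [SFinite m] :
    Measurable fun z : ℝ × X × X => ballKernel m z.1 z.2.2 z.2.1 := by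
  have h1 : MeasurableSet {z : ℝ × X × X | dist z.2.2 z.2.1 < z.1} :=
    (isOpen_lt (by fun_prop) (by fun_prop)).measurableSet
  have h2 : MeasurableSet {z : (ℝ × X) × X | dist z.2 z.1.2 < z.1.1} :=
    (isOpen_lt (by fun_prop) (by fun_prop)).measurableSet
  have h3 : Measurable fun w : ℝ × X => m (Metric.ball w.2 w.1) :=
    measurable_measure_prodMk_left h2
  have h4 : Measurable fun z : ℝ × X × X =>
      (Metric.ball z.2.1 z.1).indicator (fun _ => (1 : ℝ≥0∞)) z.2.2 :=
    (measurable_const (a := (1 : ℝ≥0∞))).indicator h1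
  exact h4.div (h3.comp (by fun_prop : Measurable fun z : ℝ × X × X => (z.1, z.2.1)))

theorem measurable_ballKernel_prod [SecondCountableTopology X] [SFinite m] (r : ℝ) :
    Measurable fun z : X × X => ballKernel m r z.2 z.1 :=
  measurable_ballKernel.comp (by fun_prop : Measurable fun z : X × X => (r, z))

variable {p : ℝ} [Fact (1 < p)]

/-- For functions of the domain, the ball functional at scale `r` is bounded by `Ψ(r)` times the
energy. -/
theorem PoincareInequality.exists_ballFunctional_le [TopologicalSpace.SeparableSpace X]
    [IsLocallyFiniteMeasure m] [m.IsOpenPosMeasure] {𝓔 : EnergyStructure m p} {Ψ : ℝ → ℝ}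
    (hPI : PoincareInequality 𝓔 Ψ) (hΨ : IsScaleFunction Ψ) (hVD : VolumeDoubling m) :
    ∃ C : ℝ, 0 < C ∧ ∀ (r : ℝ) (u : 𝓔.F), 0 < r →
      ballFunctional m p r u.1 ≤ ENNReal.ofReal (C * Ψ r) * 𝓔.E u := by
  have hp := one_lt_exponent p
  obtain ⟨CP, A, hCP, hA, hP⟩ := hPI
  obtain ⟨C, hC0, hC⟩ := hVD.exists_ball_le 3
  obtain ⟨n, hn⟩ := hVD.exists_card_le (2 * A)
  obtain ⟨D, hD0, hD⟩ := hΨ.exists_le_mul one_le_two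
  refine ⟨C * 2 ^ p * 2 * CP * D * (n + 1), by positivity, fun r u hr => ?_⟩
  obtain ⟨N, hN⟩ := exists_isNet (X := X) hr
  have hum : Measurable u.1 := (Lp.stronglyMeasurable u.1).measurable
  have hm0 : ∀ (x : X) {r : ℝ}, 0 < r → m (Metric.ball x r) ≠ 0 :=
    fun x r hr => (Metric.measure_ball_pos m x hr).ne'
  have hmt : ∀ (x : X) (r : ℝ), m (Metric.ball x r) ≠ ∞ := fun x r => (hVD.ball_lt_top x r).ne
  have step : ∀ i : N, ∫⁻ y in Metric.ball (i : X) r,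
      ∫⁻ x, ENNReal.ofReal (|u.1 x - u.1 y| ^ p) * ballKernel m r x y ∂m ∂m
      ≤ ENNReal.ofReal (C * 2 ^ p * 2 * CP * D * Ψ r)
        * (𝓔.Γ u : Measure X) (Metric.ball (i : X) (2 * A * r)) := by
    intro i
    -- For y in B(i, r) the ball B(y, r) lies in B, and B lies in B(y, 3r), so the two measures are
    -- comparable. Inserting the average c over B then reduces the estimate to the Poincaré
    -- inequality on B.
    set B := Metric.ball (i : X) (2 * r) with hB
    have hBm : MeasurableSet B := Metric.isOpen_ball.measurableSet
    have hB0 : m B ≠ 0 := hm0 _ (by positivity)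
    have hBt : m B ≠ ∞ := hmt _ _
    set c := ⨍ z in B, u.1 z ∂m
    set I := ∫⁻ y in B, ENNReal.ofReal (|u.1 y - c| ^ p) ∂m
    have h1 : ∀ y ∈ Metric.ball (i : X) r,
        ∫⁻ x, ENNReal.ofReal (|u.1 x - u.1 y| ^ p) * ballKernel m r x y ∂m
        ≤ C * (m B)⁻¹ * ∫⁻ x in B, ENNReal.ofReal (|u.1 x - u.1 y| ^ p) ∂m := by
      intro y hy
      rw [Metric.mem_ball] at hy
      rw [← lintegral_const_mul' _ _ (ENNReal.mul_ne_top ENNReal.coe_ne_top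
        (ENNReal.inv_ne_top.2 hB0)), ← lintegral_indicator hBm]
      refine lintegral_mono fun x => ?_
      rw [ballKernel]
      by_cases hx : x ∈ Metric.ball y r
      · have hxB : x ∈ B := by
          rw [Metric.mem_ball] at hx ⊢
          linarith [dist_triangle x y i]
        rw [indicator_of_mem hx, indicator_of_mem hxB, mul_comm, one_div]
        gcongr
        have h2 := hC i y r (2 * r) hr (by rw [dist_comm]; linarith)
        rw [← div_eq_mul_inv, ENNReal.le_div_iff_mul_le (Or.inl hB0) (Or.inl hBt), mul_comm,
          ← div_eq_mul_inv]
        exact ENNReal.div_le_of_le_mul h2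
      · simp [indicator_of_notMem hx]
    have h2 : ∀ y, ∫⁻ x in B, ENNReal.ofReal (|u.1 x - u.1 y| ^ p) ∂m
        ≤ ENNReal.ofReal (2 ^ p) * (I + ENNReal.ofReal (|u.1 y - c| ^ p) * m B) := by
      intro y
      calc _ ≤ ∫⁻ x in B, ENNReal.ofReal (2 ^ p) * (ENNReal.ofReal (|u.1 x - c| ^ p)
            + ENNReal.ofReal (|u.1 y - c| ^ p)) ∂m :=
            lintegral_mono fun x => ofReal_abs_sub_rpow_le (by positivity) _ _ _
        _ = _ := by
            rw [lintegral_const_mul' _ _ ENNReal.ofReal_ne_top, lintegral_add_right _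
              measurable_const, lintegral_const, Measure.restrict_apply_univ]
    calc _ ≤ ∫⁻ y in Metric.ball (i : X) r, C * (m B)⁻¹ *
          (ENNReal.ofReal (2 ^ p) * (I + ENNReal.ofReal (|u.1 y - c| ^ p) * m B)) ∂m := by
          refine setLIntegral_mono' Metric.isOpen_ball.measurableSet fun y hy => ?_
          refine (h1 y hy).trans ?_
          gcongr
          exact h2 y
      _ ≤ ∫⁻ y in B, C * (m B)⁻¹ *
          (ENNReal.ofReal (2 ^ p) * (I + ENNReal.ofReal (|u.1 y - c| ^ p) * m B)) ∂m :=
          lintegral_mono_set (Metric.ball_subset_ball (by linarith))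
      _ = C * (m B)⁻¹ * (ENNReal.ofReal (2 ^ p) * (I * m B + I * m B)) := by
          rw [lintegral_const_mul' _ _ (ENNReal.mul_ne_top ENNReal.coe_ne_top
            (ENNReal.inv_ne_top.2 hB0)), lintegral_const_mul' _ _ ENNReal.ofReal_ne_top,
            lintegral_add_left measurable_const, lintegral_mul_const' _ _ hBt, lintegral_const,
            Measure.restrict_apply_univ]
      _ = C * ENNReal.ofReal (2 ^ p) * 2 * I * ((m B)⁻¹ * m B) := by ring
      _ = C * ENNReal.ofReal (2 ^ p) * 2 * I := by
          rw [ENNReal.inv_mul_cancel hB0 hBt, mul_one]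
      _ ≤ C * ENNReal.ofReal (2 ^ p) * 2 * (ENNReal.ofReal (CP * (D * Ψ r))
          * (𝓔.Γ u : Measure X) (Metric.ball (i : X) (A * (2 * r)))) := by
          gcongr
          refine (hP i (2 * r) (by positivity) u).trans ?_
          gcongr
          exact hD r hr
      _ = _ := by
          have e : A * (2 * r) = 2 * A * r := by ring
          rw [e, ← mul_assoc]
          congr 1
          have e2 : (C : ℝ≥0∞) = ENNReal.ofReal (C : ℝ) := by simp
          have e3 : (2 : ℝ≥0∞) = ENNReal.ofReal 2 := by simp
          have := hΨ.pos hr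
          rw [e2, e3, ← ENNReal.ofReal_mul (by positivity), ← ENNReal.ofReal_mul (by positivity),
            ← ENNReal.ofReal_mul (by positivity)]
          congr 1
          ring
  calc ballFunctional m p r u.1 ≤ _ := lintegral_le_tsum_ball hN m _
    _ ≤ ∑' i : N, ENNReal.ofReal (C * 2 ^ p * 2 * CP * D * Ψ r)
        * (𝓔.Γ u : Measure X) (Metric.ball (i : X) (2 * A * r)) := ENNReal.tsum_le_tsum step
    _ ≤ ENNReal.ofReal (C * 2 ^ p * 2 * CP * D * Ψ r) * (n * (𝓔.Γ u : Measure X) univ) := by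
        rw [ENNReal.tsum_mul_left]
        gcongr
        exact tsum_measure_ball_le hN (hn r N hr hN) _
    _ ≤ _ := by
        rw [𝓔.measure_univ, FiniteMeasure.ennreal_coeFn_eq_coeFn_toMeasure, ← mul_assoc]
        gcongr
        have e : (n : ℝ≥0∞) = ENNReal.ofReal n := by simp
        have := hΨ.pos hr
        rw [e, ← ENNReal.ofReal_mul (by positivity)]
        refine ENNReal.ofReal_le_ofReal ?_
        have : 0 ≤ C * 2 ^ p * 2 * CP * D * Ψ r := by positivity
        nlinarith

end Upper

theorem lintegral_abs_rpow_lt_top {X : Type*} [MeasurableSpace X] {m : Measure X} {p : ℝ}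
    [Fact (1 < p)] (u : Lp ℝ (ENNReal.ofReal p) m) :
    ∫⁻ x, ENNReal.ofReal (|u x| ^ p) ∂m < ∞ := by
  have hp := one_lt_exponent p
  have h := lintegral_rpow_enorm_lt_top_of_eLpNorm_lt_top
    (by simpa using (zero_lt_one.trans hp)) ENNReal.ofReal_ne_top (Lp.eLpNorm_lt_top u)
  rw [ENNReal.toReal_ofReal (by positivity)] at h
  refine (lintegral_congr fun x => ?_).trans_lt h
  rw [← ENNReal.ofReal_rpow_of_nonneg (abs_nonneg _) (by positivity), ← Real.norm_eq_abs,
    ofReal_norm]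

section BesovUpper

variable {X : Type*} [MetricSpace X] [MeasurableSpace X] [BorelSpace X] {m : Measure X} {p : ℝ}
  [Fact (1 < p)]

/-- On the j-th annulus d(x, y) is at least half the outer radius, so by doubling Ψ(d(x, y)) may be
replaced by Ψ at that radius. Each annulus is then bounded by one ball functional, whose factor Ψ
cancels. -/
theorem lintegral_lintegral_mul_dyadicKernel_le [SecondCountableTopology X] [SFinite m]
    {𝓔 : EnergyStructure m p} {Ψ : ℝ → ℝ} (hΨ : IsScaleFunction Ψ) {C D : ℝ} (hC : 0 ≤ C)
    (hD : ∀ r, 0 < r → Ψ (2 * r) ≤ D * Ψ r) (u : 𝓔.F)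
    (hu : ∀ r, 0 < r → ballFunctional m p r u.1 ≤ ENNReal.ofReal (C * Ψ r) * 𝓔.E u)
    (d : ℕ → ℝ≥0) {s : ℝ} (hs : 0 < s) :
    ∫⁻ y, ∫⁻ x, ENNReal.ofReal (|u.1 x - u.1 y| ^ p / Ψ (dist x y)) * dyadicKernel m d s x y ∂m ∂m
      ≤ ENNReal.ofReal (D * C) * 𝓔.E u * ∑' j, (d j : ℝ≥0∞) := by
  have hp := one_lt_exponent p
  have hum : Measurable u.1 := (Lp.stronglyMeasurable u.1).measurable
  have hsj : ∀ j : ℕ, 0 < s / 2 ^ j := fun j => by positivity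
  set F : ℕ → X → X → ℝ≥0∞ := fun j y x => (d j * ENNReal.ofReal (D / Ψ (s / 2 ^ j))) *
    (ENNReal.ofReal (|u.1 x - u.1 y| ^ p) * ballKernel m (s / 2 ^ j) x y) with hF
  have hFm : ∀ j, Measurable fun z : X × X => F j z.1 z.2 := fun j =>
    ((measurable_difference hum).mul (measurable_ballKernel_prod _)).const_mul _
  have hpt : ∀ x y, ENNReal.ofReal (|u.1 x - u.1 y| ^ p / Ψ (dist x y)) * dyadicKernel m d s x y
      ≤ ∑' j, F j y x := by
    intro x y
    rw [dyadicKernel, ← ENNReal.tsum_mul_left]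
    refine ENNReal.tsum_le_tsum fun j => ?_
    simp only [hF, ballKernel]
    by_cases hx : x ∈ Metric.ball y (s / 2 ^ j) \ Metric.ball y (s / 2 ^ (j + 1))
    · rw [indicator_of_mem hx, indicator_of_mem hx.1]
      have h1 : s / 2 ^ (j + 1) ≤ dist x y := by
        have := hx.2
        rwa [Metric.mem_ball, not_lt] at this
      have h0 : 0 < dist x y := (hsj (j + 1)).trans_le h1
      have h2 : Ψ (s / 2 ^ j) ≤ D * Ψ (dist x y) := by
        refine le_trans (hΨ.mono (hsj j) ?_) (hD _ h0)
        rw [pow_succ, ← div_div] at h1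
        linarith
      have h3 : |u.1 x - u.1 y| ^ p / Ψ (dist x y)
          ≤ D / Ψ (s / 2 ^ j) * |u.1 x - u.1 y| ^ p := by
        rw [div_eq_inv_mul]
        gcongr
        rw [le_div_iff₀ (hΨ.pos (hsj j)), inv_mul_le_iff₀ (hΨ.pos h0), mul_comm]
        exact h2
      have hD0 : 0 ≤ D / Ψ (s / 2 ^ j) := by
        have := hΨ.pos h0
        have := hΨ.pos (hsj j)
        have : 0 < D := by
          by_contra! hneg
          nlinarith
        positivity
      calc _ ≤ ENNReal.ofReal (D / Ψ (s / 2 ^ j) * |u.1 x - u.1 y| ^ p)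
            * (d j * (1 / m (Metric.ball y (s / 2 ^ j)))) := by gcongr
        _ = _ := by rw [ENNReal.ofReal_mul hD0]; ring
    · rw [indicator_of_notMem hx]
      simp
  calc _ ≤ ∫⁻ y, ∫⁻ x, ∑' j, F j y x ∂m ∂m :=
        lintegral_mono fun y => lintegral_mono fun x => hpt x y
    _ = ∫⁻ y, ∑' j, ∫⁻ x, F j y x ∂m ∂m := by
        refine lintegral_congr fun y => lintegral_tsum fun j => ?_
        exact ((hFm j).comp measurable_prodMk_left).aemeasurable
    _ = ∑' j, ∫⁻ y, ∫⁻ x, F j y x ∂m ∂m :=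
        lintegral_tsum fun j => (hFm j).lintegral_prod_right'.aemeasurable
    _ = ∑' j, d j * ENNReal.ofReal (D / Ψ (s / 2 ^ j)) * ballFunctional m p (s / 2 ^ j) u.1 := by
        refine tsum_congr fun j => ?_
        have hne : (d j : ℝ≥0∞) * ENNReal.ofReal (D / Ψ (s / 2 ^ j)) ≠ ∞ :=
          ENNReal.mul_ne_top ENNReal.coe_ne_top ENNReal.ofReal_ne_top
        rw [ballFunctional, ← lintegral_const_mul' _ _ hne]
        refine lintegral_congr fun y => ?_
        rw [← lintegral_const_mul' _ _ hne]
    _ ≤ ∑' j, ENNReal.ofReal (D * C) * 𝓔.E u * d j := by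
        refine ENNReal.tsum_le_tsum fun j => ?_
        calc _ ≤ d j * ENNReal.ofReal (D / Ψ (s / 2 ^ j))
              * (ENNReal.ofReal (C * Ψ (s / 2 ^ j)) * 𝓔.E u) := by gcongr; exact hu _ (hsj j)
          _ = d j * (ENNReal.ofReal (C * Ψ (s / 2 ^ j)) * ENNReal.ofReal (D / Ψ (s / 2 ^ j)))
              * 𝓔.E u := by ring
          _ = d j * ENNReal.ofReal (D * C) * 𝓔.E u := by
              have := hΨ.pos (hsj j)
              rw [← ENNReal.ofReal_mul (by positivity)]
              congr 3
              field_simp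
          _ = _ := by ring
    _ = _ := ENNReal.tsum_mul_left

theorem limsup_besovFunctional_lt_top_of_local [TopologicalSpace.SeparableSpace X]
    [IsLocallyFiniteMeasure m] [m.IsOpenPosMeasure] {𝓔 : EnergyStructure m p} {Ψ : ℝ → ℝ}
    (hPI : PoincareInequality 𝓔 Ψ) (hΨ : IsScaleFunction Ψ) (hVD : VolumeDoubling m)
    {ρ : ℝ → X → X → ℝ≥0} {C : ℝ} (hρ : KernelUpperLocal m ρ C) (u : 𝓔.F) :
    limsup (fun ε => besovFunctional m p Ψ (ρ ε) u.1) (𝓝[>] 0) < ∞ := by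
  have hp := one_lt_exponent p
  have : SecondCountableTopology X := UniformSpace.secondCountable_of_separable X
  obtain ⟨K, hK0, hK⟩ := hPI.exists_ballFunctional_le hΨ hVD
  obtain ⟨D, hD0, hD⟩ := hΨ.exists_le_mul one_le_two
  obtain ⟨d, hd⟩ := hρ
  refine lt_of_le_of_lt (b := ENNReal.ofReal (D * K) * 𝓔.E u * ENNReal.ofReal C)
    (limsup_le_of_le (h := ?_)) (by finiteness)
  filter_upwards [self_mem_nhdsWithin] with ε hε
  rw [mem_Ioi] at hε
  refine le_trans (lintegral_mono fun y => lintegral_mono fun x => ?_)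
    ((lintegral_lintegral_mul_dyadicKernel_le hΨ hK0.le hD u (fun r hr => hK r u hr) (d ε) hε).trans
      (by gcongr; exact (hd ε hε).1))
  -- The value of Ψ at 0 is arbitrary, but 0^p = 0 annihilates the integrand on the diagonal.
  by_cases hxy : x = y
  · subst hxy
    simp [Real.zero_rpow (by positivity : p ≠ 0)]
  · gcongr
    exact (hd ε hε).2 x y hxy

/-- Pairs at distance less than 1 are handled by the dyadic majorant. For the others |u(x) - u(y)|^p
≤ 2^p (|u(x)|^p + |u(y)|^p), and the two tail limits bound the kernel's integral in either variable,
as in Schur's test. -/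
theorem limsup_besovFunctional_lt_top_of_fixed [TopologicalSpace.SeparableSpace X]
    [IsLocallyFiniteMeasure m] [m.IsOpenPosMeasure] {𝓔 : EnergyStructure m p} {Ψ : ℝ → ℝ}
    (hPI : PoincareInequality 𝓔 Ψ) (hΨ : IsScaleFunction Ψ) (hVD : VolumeDoubling m)
    {ρ : ℝ → X → X → ℝ≥0} (hρm : ∀ ε : ℝ, 0 < ε → Measurable fun z : X × X => ρ ε z.1 z.2) {C : ℝ}
    (hρ : KernelUpperFixed m ρ C) (hT : KernelTail m Ψ ρ) (u : 𝓔.F) :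
    limsup (fun ε => besovFunctional m p Ψ (ρ ε) u.1) (𝓝[>] 0) < ∞ := by
  have hp := one_lt_exponent p
  have : SecondCountableTopology X := UniformSpace.secondCountable_of_separable X
  obtain ⟨K, hK0, hK⟩ := hPI.exists_ballFunctional_le hΨ hVD
  obtain ⟨D, hD0, hD⟩ := hΨ.exists_le_mul one_le_two
  obtain ⟨d, hd⟩ := hρ
  have hum : Measurable u.1 := (Lp.stronglyMeasurable u.1).measurable
  set I := ∫⁻ x, ENNReal.ofReal (|u.1 x| ^ p) ∂m with hI
  have hIt : I < ∞ := lintegral_abs_rpow_lt_top u.1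
  have hT1 := (hT 1 one_pos).1.eventually (gt_mem_nhds zero_lt_one)
  have hT2 := (hT 1 one_pos).2.eventually (gt_mem_nhds zero_lt_one)
  refine lt_of_le_of_lt (b := ENNReal.ofReal (D * K) * 𝓔.E u * ENNReal.ofReal C
    + ENNReal.ofReal (2 ^ p) * (I + I)) (limsup_le_of_le (h := ?_)) (by finiteness)
  filter_upwards [self_mem_nhdsWithin, hT1, hT2] with ε hε hε1 hε2
  rw [mem_Ioi] at hε
  set G : X → X → ℝ≥0∞ := fun x y => (Metric.ball y 1)ᶜ.indicator
    (fun x => (ρ ε x y : ℝ≥0∞) / ENNReal.ofReal (Ψ (dist x y))) x with hG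
  have hGm : Measurable fun z : X × X => G z.1 z.2 := by
    have h1 : MeasurableSet {z : X × X | 1 ≤ dist z.1 z.2} :=
      (isClosed_le continuous_const (by fun_prop)).measurableSet
    have h2 : Measurable fun z : X × X =>
        (ρ ε z.1 z.2 : ℝ≥0∞) / ENNReal.ofReal ((Ioi 0).indicator Ψ (dist z.1 z.2)) :=
      (hρm ε hε).coe_nnreal_ennreal.div (hΨ.measurable_indicator.comp measurable_dist).ennreal_ofReal
    convert h2.indicator h1 using 1
    ext z
    simp only [hG]
    by_cases hz : 1 ≤ dist z.1 z.2
    · rw [indicator_of_mem (by simpa using hz), indicator_of_mem (by exact hz),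
        indicator_of_mem (by simpa using one_pos.trans_le hz)]
    · rw [indicator_of_notMem (by simpa using hz), indicator_of_notMem (by exact hz)]
  have hG1 : ∀ᵐ y ∂m, ∫⁻ x, G x y ∂m ≤ 1 := by
    filter_upwards [ENNReal.ae_le_essSup (μ := m) fun y => ∫⁻ x in (Metric.ball y 1)ᶜ,
      (ρ ε x y : ℝ≥0∞) / ENNReal.ofReal (Ψ (dist x y)) ∂m] with y hy
    rw [lintegral_indicator Metric.isOpen_ball.measurableSet.compl]
    exact hy.trans hε1.le
  have hG2 : ∀ᵐ x ∂m, ∫⁻ y, G x y ∂m ≤ 1 := by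
    filter_upwards [ENNReal.ae_le_essSup (μ := m) fun y => ∫⁻ x in (Metric.ball y 1)ᶜ,
      (ρ ε y x : ℝ≥0∞) / ENNReal.ofReal (Ψ (dist x y)) ∂m] with x hx
    refine le_trans (le_of_eq ?_) (hx.trans hε2.le)
    rw [← lintegral_indicator Metric.isOpen_ball.measurableSet.compl]
    refine lintegral_congr fun y => ?_
    by_cases h : dist x y < 1
    · have h' : dist y x < 1 := by rwa [dist_comm]
      simp [hG, h, h']
    · have h' : ¬ dist y x < 1 := by rwa [dist_comm]
      simp only [hG]
      rw [indicator_of_mem (by simpa using h), indicator_of_mem (by simpa using h'), dist_comm x y]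
  have hpt : ∀ x y, ENNReal.ofReal (|u.1 x - u.1 y| ^ p / Ψ (dist x y)) * (ρ ε x y : ℝ≥0∞)
      ≤ ENNReal.ofReal (|u.1 x - u.1 y| ^ p / Ψ (dist x y)) * dyadicKernel m (d ε) 1 x y
        + ENNReal.ofReal (2 ^ p) * (ENNReal.ofReal (|u.1 x| ^ p) * G x y
          + ENNReal.ofReal (|u.1 y| ^ p) * G x y) := by
    intro x y
    by_cases hxy : x = y
    · subst hxy
      simp [Real.zero_rpow (by positivity : p ≠ 0)]
    rcases lt_or_ge (dist x y) 1 with h | h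
    · refine le_add_right ?_
      gcongr
      exact (hd ε hε).2 x y hxy h
    · refine le_add_left ?_
      have h1 := ofReal_abs_sub_rpow_le (by positivity : 0 ≤ p) (u.1 x) (u.1 y) 0
      simp only [sub_zero] at h1
      have hG' : G x y = (ρ ε x y : ℝ≥0∞) / ENNReal.ofReal (Ψ (dist x y)) :=
        indicator_of_mem (by simpa using h) _
      rw [← add_mul, ← mul_assoc, hG', ENNReal.ofReal_div_of_pos (hΨ.pos (one_pos.trans_le h)),
        ENNReal.mul_comm_div]
      gcongr
  have h1 : ∫⁻ y, ∫⁻ x, ENNReal.ofReal (|u.1 y| ^ p) * G x y ∂m ∂m ≤ I := by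
    refine lintegral_mono_ae ?_
    filter_upwards [hG1] with y hy
    rw [lintegral_const_mul' _ _ ENNReal.ofReal_ne_top]
    exact mul_le_of_le_one_right' hy
  have h2 : ∫⁻ y, ∫⁻ x, ENNReal.ofReal (|u.1 x| ^ p) * G x y ∂m ∂m ≤ I := by
    rw [lintegral_lintegral_swap]
    · refine lintegral_mono_ae ?_
      filter_upwards [hG2] with x hx
      rw [lintegral_const_mul' _ _ ENNReal.ofReal_ne_top]
      exact mul_le_of_le_one_right' hx
    · refine Measurable.aemeasurable ?_
      exact Measurable.mul (by fun_prop) (hGm.comp measurable_swap)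
  have hmx : Measurable fun z : X × X => ENNReal.ofReal (|u.1 z.1| ^ p) * G z.1 z.2 :=
    Measurable.mul (by fun_prop) hGm
  have hmy : Measurable fun z : X × X => ENNReal.ofReal (|u.1 z.2| ^ p) * G z.1 z.2 :=
    Measurable.mul (by fun_prop) hGm
  calc besovFunctional m p Ψ (ρ ε) u.1 ≤ _ :=
        lintegral_mono fun y => lintegral_mono fun x => hpt x y
    _ = ∫⁻ y, ∫⁻ x, ENNReal.ofReal (|u.1 x - u.1 y| ^ p / Ψ (dist x y))
          * dyadicKernel m (d ε) 1 x y ∂m ∂m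
        + ENNReal.ofReal (2 ^ p) * (∫⁻ y, ∫⁻ x, ENNReal.ofReal (|u.1 x| ^ p) * G x y ∂m ∂m
          + ∫⁻ y, ∫⁻ x, ENNReal.ofReal (|u.1 y| ^ p) * G x y ∂m ∂m) := by
        rw [← lintegral_add_left hmx.lintegral_prod_left',
          ← lintegral_const_mul' _ _ ENNReal.ofReal_ne_top, ← lintegral_add_right]
        · refine lintegral_congr fun y => ?_
          have hmxy := hmx.comp (measurable_prodMk_right (y := y))
          have hmyy := hmy.comp (measurable_prodMk_right (y := y))
          have e := lintegral_add_left hmxy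
            (μ := m) (fun x => ENNReal.ofReal (|u.1 y| ^ p) * G x y)
          simp only [Function.comp_apply] at e
          rw [← e, ← lintegral_const_mul' _ _ ENNReal.ofReal_ne_top, ← lintegral_add_right]
          exact (hmxy.add hmyy).const_mul _
        · exact (hmx.lintegral_prod_left'.add hmy.lintegral_prod_left').const_mul _
    _ ≤ _ := by
        gcongr
        refine (lintegral_lintegral_mul_dyadicKernel_le hΨ hK0.le hD u (fun r hr => hK r u hr)
          (d ε) one_pos).trans ?_
        gcongr
        exact (hd ε hε).1

end BesovUpper

/-! ### Scales with controlled ball functional -/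

/-- The Radon measure may have infinite mass near 0; σ-finiteness on (0, ∞) is what Tonelli's
theorem needs when integrating over scales. -/
theorem sigmaFinite_restrict_Ioi {ν : Measure ℝ} (hν : ∀ a b : ℝ, 0 < a → ν (Icc a b) < ∞) :
    SigmaFinite (ν.restrict (Ioi 0)) := by
  refine ⟨⟨⟨fun n => Icc (1 / ((n : ℝ) + 1)) n ∪ Iic 0, fun _ => mem_univ _, fun n => ?_,
    eq_univ_of_forall fun t => ?_⟩⟩⟩
  · rw [Measure.restrict_apply (measurableSet_Icc.union measurableSet_Iic)]
    refine lt_of_le_of_lt (measure_mono ?_) (hν (1 / ((n : ℝ) + 1)) n (by positivity))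
    rintro t ⟨h | h, h0⟩
    · exact h
    · exact absurd h0 (notMem_Ioi.2 h)
  · rcases le_or_gt t 0 with h | h
    · exact mem_iUnion.2 ⟨0, Or.inr h⟩
    · obtain ⟨k, hk⟩ := exists_nat_one_div_lt h
      obtain ⟨l, hl⟩ := exists_nat_ge t
      refine mem_iUnion.2 ⟨max k l, Or.inl ⟨?_, hl.trans (by simp)⟩⟩
      refine le_trans ?_ hk.le
      refine one_div_le_one_div_of_le (by positivity) ?_
      gcongr
      exact le_max_left _ _

theorem ballFunctional_le_besovFunctional {X : Type*} [MetricSpace X] [MeasurableSpace X]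
    {m : Measure X} {p : ℝ} (hp : 0 < p) {Ψ : ℝ → ℝ}
    (hΨ : IsScaleFunction Ψ) {k : X → X → ℝ≥0} {C ε : ℝ} (hC : 0 < C) (hε : 0 < ε) (hε1 : ε ≤ 1)
    (hk : ∀ x y : X, x ≠ y → dist x y ≤ 1 → ENNReal.ofReal (C⁻¹ * (Ψ (dist x y) / Ψ ε)) *
      ((Metric.ball y ε).indicator (fun _ => 1) x / m (Metric.ball y ε)) ≤ (k x y : ℝ≥0∞))
    (u : X → ℝ) :
    ballFunctional m p ε u ≤ ENNReal.ofReal (C * Ψ ε) * besovFunctional m p Ψ k u := by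
  rw [besovFunctional, ← lintegral_const_mul' _ _ ENNReal.ofReal_ne_top]
  refine lintegral_mono fun y => ?_
  rw [← lintegral_const_mul' _ _ ENNReal.ofReal_ne_top]
  refine lintegral_mono fun x => ?_
  by_cases hxy : x = y
  · subst hxy
    simp [Real.zero_rpow hp.ne']
  by_cases hx : x ∈ Metric.ball y ε
  · have hd : 0 < dist x y := dist_pos.2 hxy
    have h1 := hΨ.pos hd
    have h2 := hΨ.pos hε
    refine le_trans ?_ (mul_le_mul_right (mul_le_mul_right
      (hk x y hxy ((Metric.mem_ball.1 hx).le.trans hε1)) _) _)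
    rw [← mul_assoc, ← mul_assoc, ← ENNReal.ofReal_mul (by positivity),
      ← ENNReal.ofReal_mul (by positivity), ballKernel]
    gcongr
    refine le_of_eq ?_
    field_simp
  · rw [ballKernel, indicator_of_notMem hx]
    simp

section Scales

variable {X : Type*} [MetricSpace X] [MeasurableSpace X] [BorelSpace X] {m : Measure X}

/-- By Tonelli the scale integral falls on the kernel. `ballKernel m t x y` vanishes unless t > d(x,
y), and then it is at most 1 / m(B(y, d(x, y))), so its integral is at most ν((d, ∞)) / m(B(y, d)).
Only pairs with d(x, y) < δ ≤ 1 contribute, where the kernel bound applies. -/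
theorem lintegral_ballFunctional_le [SecondCountableTopology X] [SFinite m] {p : ℝ} (hp : 0 < p)
    {Ψ : ℝ → ℝ} (hΨ : IsScaleFunction Ψ) {ν : Measure ℝ}
    (hν : ∀ a b : ℝ, 0 < a → ν (Icc a b) < ∞) {k : X → X → ℝ≥0}
    (hk : ∀ x y : X, x ≠ y → dist x y ≤ 1 → ENNReal.ofReal (Ψ (dist x y)) *
      (ν (Ioi (dist x y)) / m (Metric.ball y (dist x y))) ≤ (k x y : ℝ≥0∞))
    {u : X → ℝ} (hu : Measurable u) {δ : ℝ} (hδ : δ ≤ 1) :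
    ∫⁻ t in Ioc 0 δ, ballFunctional m p t u ∂ν ≤ besovFunctional m p Ψ k u := by
  have hσ : SigmaFinite (ν.restrict (Ioc 0 δ)) := by
    have h1 := sigmaFinite_restrict_Ioi hν
    have h2 : ν.restrict (Ioc 0 δ) = (ν.restrict (Ioi 0)).restrict (Ioc 0 δ) := by
      rw [Measure.restrict_restrict measurableSet_Ioc, inter_eq_left.2 Ioc_subset_Ioi_self]
    rw [h2]
    infer_instance
  set F : ℝ → X × X → ℝ≥0∞ := fun t z =>
    ENNReal.ofReal (|u z.2 - u z.1| ^ p) * ballKernel m t z.2 z.1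
  have hF : Measurable (Function.uncurry F) :=
    ((measurable_difference hu).comp measurable_snd).mul measurable_ballKernel
  have h1 : ∀ t, ballFunctional m p t u = ∫⁻ z, F t z ∂(m.prod m) := fun t =>
    (lintegral_prod _ (hF.comp measurable_prodMk_left).aemeasurable).symm
  simp only [h1]
  have h2 : ∫⁻ z, ∫⁻ t in Ioc 0 δ, F t z ∂ν ∂(m.prod m)
      = ∫⁻ y, ∫⁻ x, ∫⁻ t in Ioc 0 δ, F t (y, x) ∂ν ∂m ∂m :=
    lintegral_prod _ hF.lintegral_prod_left'.aemeasurable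
  rw [lintegral_lintegral_swap hF.aemeasurable, h2]
  refine lintegral_mono fun y => lintegral_mono fun x => ?_
  by_cases hxy : x = y
  · subst hxy
    simp [F, Real.zero_rpow hp.ne']
  have hd : 0 < dist x y := dist_pos.2 hxy
  simp only [F]
  rw [lintegral_const_mul' _ _ ENNReal.ofReal_ne_top, ENNReal.ofReal_div_of_pos (hΨ.pos hd),
    ENNReal.mul_comm_div]
  gcongr
  rcases lt_or_ge (dist x y) δ with h | h
  · rw [ENNReal.le_div_iff_mul_le (Or.inl (ENNReal.ofReal_pos.2 (hΨ.pos hd)).ne')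
      (Or.inl ENNReal.ofReal_ne_top), mul_comm]
    refine le_trans ?_ (hk x y hxy (h.le.trans hδ))
    gcongr
    calc ∫⁻ t in Ioc 0 δ, ballKernel m t x y ∂ν
        ≤ ∫⁻ t, (Ioi (dist x y)).indicator (fun _ => (m (Metric.ball y (dist x y)))⁻¹) t ∂ν := by
          refine (setLIntegral_le_lintegral _ _).trans (lintegral_mono fun t => ?_)
          rw [ballKernel]
          by_cases ht : dist x y < t
          · rw [indicator_of_mem (by exact ht), indicator_of_mem (by exact ht), one_div]
            gcongr
          · rw [indicator_of_notMem (by exact ht)]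
            simp
      _ = _ := by
          rw [lintegral_indicator measurableSet_Ioi, lintegral_const, Measure.restrict_apply_univ,
            mul_comm, div_eq_mul_inv]
  · refine le_of_eq_of_le (lintegral_eq_zero_of_ae_eq_zero ?_) zero_le
    filter_upwards [ae_restrict_mem measurableSet_Ioc] with t ht
    rw [ballKernel, indicator_of_notMem]
    · simp
    · rw [Metric.mem_ball, not_lt]
      exact ht.2.trans h

/-- If the Besov functionals have finite lower limit, then the ball functional at scale `t` is at
most a multiple of `Ψ(t)` for arbitrarily small `t`. -/
theorem exists_ballFunctional_le_of_liminf [SecondCountableTopology X] [SFinite m] {p : ℝ}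
    (hp : 0 < p) {Ψ : ℝ → ℝ} (hΨ : IsScaleFunction Ψ) {ρ : ℝ → X → X → ℝ≥0} {C : ℝ} (hC : 0 < C)
    (hρ : KernelLower m Ψ ρ C) {u : X → ℝ} (hu : Measurable u)
    (h : liminf (fun ε => besovFunctional m p Ψ (ρ ε) u) (𝓝[>] 0) < ∞) :
    ∃ M : ℝ, 0 < M ∧ ∀ δ : ℝ, 0 < δ → ∃ t, 0 < t ∧ t ≤ δ ∧
      ballFunctional m p t u ≤ ENNReal.ofReal (M * Ψ t) := by
  obtain ⟨ν, hν, hνΨ, hlow⟩ := hρ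
  obtain ⟨b, hb1, hb2⟩ := exists_between h
  set M := b.toReal + 1 with hM
  have hM0 : 0 < M := by positivity
  have hbM : b ≤ ENNReal.ofReal M := by
    rw [← ENNReal.ofReal_toReal hb2.ne]
    exact ENNReal.ofReal_le_ofReal (by linarith)
  have hfreq : ∃ᶠ ε in 𝓝[>] (0 : ℝ), besovFunctional m p Ψ (ρ ε) u < b :=
    frequently_lt_of_liminf_lt (by isBoundedDefault) hb1
  -- Eventually the integral of Ψ over (0, δ'] exceeds 1/(2C). If every scale in that range violated
  -- the bound with 2CM, integration would give a Besov functional of at least M ≥ b, contrary to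
  -- the choice of ε. In the other alternative of the kernel bound, t = ε works directly.
  refine ⟨2 * C * M, by positivity, fun δ hδ => ?_⟩
  set δ' := min δ 1 with hδ'
  have hδ0 : 0 < δ' := lt_min hδ one_pos
  have hlt : ENNReal.ofReal (2 * C)⁻¹ <
      liminf (fun ε => ∫⁻ t in Ioc 0 δ', ENNReal.ofReal (Ψ t) ∂(ν ε)) (𝓝[>] 0) := by
    refine lt_of_lt_of_le ?_ (hνΨ δ' hδ0)
    rw [ENNReal.ofReal_lt_ofReal_iff (by positivity)]
    exact inv_strictAnti₀ hC (by linarith)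
  have hev := eventually_lt_of_lt_liminf hlt
  obtain ⟨ε, hεb, hεν, hε0, hεδ⟩ := (hfreq.and_eventually (hev.and
    (Ioc_mem_nhdsGT hδ0 : ∀ᶠ ε in 𝓝[>] (0 : ℝ), ε ∈ Ioc 0 δ'))).exists
  rcases hlow ε hε0 with hk | hk
  · refine ⟨ε, hε0, hεδ.trans (min_le_left _ _), ?_⟩
    have hΨε := hΨ.pos hε0
    calc ballFunctional m p ε u ≤ ENNReal.ofReal (C * Ψ ε) * besovFunctional m p Ψ (ρ ε) u :=
          ballFunctional_le_besovFunctional hp hΨ hC hε0 (hεδ.trans (min_le_right _ _)) hk u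
      _ ≤ ENNReal.ofReal (C * Ψ ε) * ENNReal.ofReal M := by
          gcongr
          exact hεb.le.trans hbM
      _ ≤ _ := by
          rw [← ENNReal.ofReal_mul (by positivity)]
          refine ENNReal.ofReal_le_ofReal ?_
          have : 0 < C * Ψ ε * M := by positivity
          nlinarith
  · by_contra! hcon
    have h1 := lintegral_ballFunctional_le (p := p) hp hΨ (hν ε hε0) hk hu (min_le_right δ 1)
    have h2 : ENNReal.ofReal (2 * C * M) * ∫⁻ t in Ioc 0 δ', ENNReal.ofReal (Ψ t) ∂(ν ε)
        ≤ ∫⁻ t in Ioc 0 δ', ballFunctional m p t u ∂(ν ε) := by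
      rw [← lintegral_const_mul' _ _ ENNReal.ofReal_ne_top]
      refine setLIntegral_mono' measurableSet_Ioc fun t ht => ?_
      rw [← ENNReal.ofReal_mul (by positivity)]
      exact (hcon t ht.1 (ht.2.trans (min_le_left _ _))).le
    have h3 : ENNReal.ofReal M ≤
        ENNReal.ofReal (2 * C * M) * ∫⁻ t in Ioc 0 δ', ENNReal.ofReal (Ψ t) ∂(ν ε) := by
      calc ENNReal.ofReal M = ENNReal.ofReal (2 * C * M) * ENNReal.ofReal (2 * C)⁻¹ := by
            rw [← ENNReal.ofReal_mul (by positivity)]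
            congr 1
            field_simp
        _ ≤ _ := by gcongr
    exact absurd (hεb.trans_le hbM) (not_lt.2 (h3.trans (h2.trans h1)))

end Scales

/-! ### Partitions of unity with controlled energy -/

/-- Telescoping of running maxima in the order given by `e`: adding the last index changes no
earlier summand and contributes exactly the increase of the maximum. -/
theorem sum_posPart_sub_fold_max {ι : Type*} [DecidableEq ι] (e : ι → ℕ)
    (he : Function.Injective e) (a : ι → ℝ) (T : Finset ι) :
    ∑ i ∈ T, max (a i - (T.filter fun j => e j < e i).fold max 0 a) 0 = T.fold max 0 a := by
  induction T using Finset.induction_on_max_value e with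
  | empty => simp
  | insert i T hi hmax ih =>
    have h1 : ((insert i T).filter fun j => e j < e i) = T := by
      ext j
      simp only [Finset.mem_filter, Finset.mem_insert]
      constructor
      · rintro ⟨rfl | h, hlt⟩
        · exact absurd hlt (lt_irrefl _)
        · exact h
      · intro h
        exact ⟨Or.inr h, lt_of_le_of_ne (hmax j h) fun h' => hi (he h' ▸ h)⟩
    have h2 : ∀ k ∈ T, ((insert i T).filter fun j => e j < e k) = T.filter fun j => e j < e k := by
      intro k hk
      rw [Finset.filter_insert, if_neg (not_lt.2 (hmax k hk))]
    rw [Finset.sum_insert hi, h1, Finset.fold_insert hi,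
      Finset.sum_congr rfl fun k hk => by rw [h2 k hk], ih]
    rcases le_total (a i) (T.fold max 0 a) with h | h
    · rw [max_eq_right (by linarith), max_eq_right h, zero_add]
    · rw [max_eq_left (by linarith), max_eq_left h, sub_add_cancel]

/-- The maximum may run over neighbours only: nonzero competitors of an index with a_i ≠ 0 are
neighbours, and when a_i = 0 the summand vanishes either way. Each partition function thus involves
boundedly many bumps. -/
theorem sum_posPart_sub_fold_max_eq_one {ι : Type*} [DecidableEq ι] (e : ι → ℕ)
    (he : Function.Injective e) (a : ι → ℝ) (ha : ∀ i, 0 ≤ a i ∧ a i ≤ 1) (nbr : ι → Finset ι)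
    (hnbr : ∀ i j, a i ≠ 0 → a j ≠ 0 → j ∈ nbr i) (T : Finset ι) (hT : ∀ j, a j ≠ 0 → j ∈ T)
    {k : ι} (hk : a k = 1) :
    ∑ i ∈ T, max (a i - ((nbr i).filter fun j => e j < e i).fold max 0 a) 0 = 1 := by
  have h0 : ∀ S : Finset ι, 0 ≤ S.fold max 0 a := fun S => Finset.le_fold_max _ |>.2 (Or.inl le_rfl)
  have key : ∀ S S' : Finset ι, (∀ j ∈ S, a j ≠ 0 → j ∈ S') → S.fold max 0 a ≤ S'.fold max 0 a := by
    intro S S' h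
    refine (Finset.fold_max_le _).2 ⟨h0 S', fun j hj => ?_⟩
    by_cases hj0 : a j = 0
    · rw [hj0]
      exact h0 S'
    · exact (Finset.le_fold_max _).2 (Or.inr ⟨j, h j hj hj0, le_rfl⟩)
  have h1 : T.fold max 0 a = 1 := by
    refine le_antisymm ((Finset.fold_max_le _).2 ⟨zero_le_one, fun j _ => (ha j).2⟩) ?_
    exact (Finset.le_fold_max _).2 (Or.inr ⟨k, hT k (by rw [hk]; exact one_ne_zero), hk.ge⟩)
  rw [← h1, ← sum_posPart_sub_fold_max e he a T]
  refine Finset.sum_congr rfl fun i _ => ?_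
  by_cases hi : a i = 0
  · rw [hi, max_eq_right (by linarith [h0 ((nbr i).filter fun j => e j < e i)]),
      max_eq_right (by linarith [h0 (T.filter fun j => e j < e i)])]
  · congr 2
    refine le_antisymm (key _ _ fun j hj hj0 => ?_) (key _ _ fun j hj hj0 => ?_)
    · exact Finset.mem_filter.2 ⟨hT j hj0, (Finset.mem_filter.1 hj).2⟩
    · exact Finset.mem_filter.2 ⟨hnbr i j hi hj0, (Finset.mem_filter.1 hj).2⟩

section Partition

variable {X : Type*} [MetricSpace X] [MeasurableSpace X] [BorelSpace X] {m : Measure X} {p : ℝ}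
  [Fact (1 < p)]

theorem hasEnergyLE_fold_max {𝓔 : EnergyStructure m p} {ι : Type*} (T : Finset ι)
    {h : ι → X → ℝ} {c : ι → ℝ} (hh : ∀ i ∈ T, HasEnergyLE 𝓔 (h i) (c i)) :
    HasEnergyLE 𝓔 (fun x => T.fold max 0 fun i => h i x) (∑ i ∈ T, c i) := by
  classical
  induction T using Finset.induction_on with
  | empty => simpa using HasEnergyLE.zero
  | insert i T hi ih =>
    simp only [Finset.sum_insert hi, Finset.fold_insert hi]
    exact (hh i (by simp)).max (ih fun j hj => hh j (by simp [hj]))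

theorem CapacityUpperBound.exists_bump [Nontrivial X] [IsLocallyFiniteMeasure m]
    [m.IsOpenPosMeasure] {𝓔 : EnergyStructure m p} {Ψ : ℝ → ℝ} (hcap : CapacityUpperBound 𝓔 Ψ)
    (hΨ : IsScaleFunction Ψ) (hVD : VolumeDoubling m) :
    ∃ C A s₀ : ℝ, 0 < C ∧ 1 < A ∧ 0 < s₀ ∧ ∀ (x : X) (s : ℝ), 0 < s → s < s₀ → ∃ h : X → ℝ,
      HasEnergyLE 𝓔 h ((C * (m (Metric.ball x s)).toReal / Ψ s) ^ (1 / p)) ∧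
      (∀ y, 0 ≤ h y ∧ h y ≤ 1) ∧ (∀ y, dist y x < s → h y = 1) ∧
      ∀ y, A * s ≤ dist y x → h y = 0 := by
  classical
  have hp := one_lt_exponent p
  obtain ⟨C, A, A₂, hC, hA, hA₂, hcap⟩ := hcap
  obtain ⟨a, b, hab⟩ := exists_pair_ne X
  have hdab := dist_pos.2 hab
  -- Two distinct points bound the diameter from below. The factor 2 makes the capacity bound
  -- strict, so some admissible function satisfies it although the infimum need not be attained.
  refine ⟨2 * C, A, dist a b / A₂, by positivity, hA, by positivity, fun x s hs hs0 => ?_⟩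
  have hB0 := Metric.measure_ball_pos m x hs
  have hBt := hVD.ball_lt_top x s
  have hΨs := hΨ.pos hs
  set μ := (m (Metric.ball x s)).toReal with hμ
  have hμ0 : 0 < μ := ENNReal.toReal_pos hB0.ne' hBt.ne
  have h1 := hcap x s hs (by
    refine ((ENNReal.ofReal_lt_ofReal_iff (by positivity)).2 hs0).trans_le ?_
    rw [ENNReal.ofReal_div_of_pos (by positivity)]
    gcongr
    rw [← edist_dist]
    exact Metric.edist_le_ediam_of_mem (mem_univ _) (mem_univ _))
  have h2 : ENNReal.ofReal C * m (Metric.ball x s) / ENNReal.ofReal (Ψ s)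
      < ENNReal.ofReal (2 * C * μ / Ψ s) := by
    rw [← ENNReal.ofReal_toReal hBt.ne, ← ENNReal.ofReal_mul (by positivity),
      ← ENNReal.ofReal_div_of_pos hΨs, ENNReal.ofReal_lt_ofReal_iff (by positivity)]
    have : 0 < C * μ := by positivity
    gcongr
    linarith
  obtain ⟨u, hu⟩ := iInf_lt_iff.1 (h1.trans_lt h2)
  obtain ⟨⟨hu1, hu0⟩, hE⟩ := iInf_lt_iff.1 hu
  have hE' : (𝓔.E u : ℝ) ≤ 2 * C * μ / Ψ s := by
    rw [← ENNReal.ofReal_coe_nnreal] at hE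
    exact (ENNReal.ofReal_lt_ofReal_iff'.1 hE).1.le
  have hL : HasEnergyLE 𝓔 u.1 ((2 * C * μ / Ψ s) ^ (1 / p)) :=
    ⟨u, EventuallyEq.rfl, by gcongr⟩
  -- Redefinition on a null set turns the a.e. boundary values into pointwise ones.
  refine ⟨fun y => if dist y x < s then 1 else if A * s ≤ dist y x then 0 else
    min (max (u.1 y) 0) 1, (hL.clamp zero_le_one).congr ?_, fun y => ?_, fun y hy => if_pos hy,
    fun y hy => ?_⟩
  · filter_upwards [hu1, hu0] with y hy1 hy0
    split_ifs with h h'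
    · rw [hy1 h]
      simp
    · rw [hy0 (by simpa using h')]
      simp
    · rfl
  · dsimp only
    split_ifs
    · exact ⟨zero_le_one, le_rfl⟩
    · exact ⟨le_rfl, zero_le_one⟩
    · exact ⟨le_min (le_max_right _ _) zero_le_one, min_le_right _ _⟩
  · have : ¬ dist y x < s := not_lt.2 (le_trans (by nlinarith) hy)
    dsimp only
    rw [if_neg this, if_pos hy]

theorem VolumeDoubling.finite_setOf_dist_lt [IsLocallyFiniteMeasure m] [m.IsOpenPosMeasure]
    (hVD : VolumeDoubling m) {s : ℝ} (hs : 0 < s) {N : Set X} (hN : IsNet s N) (x : X) (r : ℝ) :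
    {i : N | dist x i < r}.Finite := by
  obtain ⟨n, hn⟩ := hVD.exists_card_le (r / s)
  by_contra h
  obtain ⟨T, hT, hc⟩ := Set.Infinite.exists_subset_card_eq h (n + 1)
  have := hn s N hs hN x T fun i hi => by
    rw [div_mul_cancel₀ _ hs.ne']
    exact hT hi
  omega

/-- The points of the net `N` at distance less than `r` from `x`. -/
def IsNet.nbr {s : ℝ} {N : Set X} (hN : IsNet s N) (hs : 0 < s) [IsLocallyFiniteMeasure m]
    [m.IsOpenPosMeasure] (hVD : VolumeDoubling m) (x : X) (r : ℝ) : Finset N :=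
  (hVD.finite_setOf_dist_lt hs hN x r).toFinset

theorem IsNet.mem_nbr {s : ℝ} {N : Set X} (hN : IsNet s N) (hs : 0 < s) [IsLocallyFiniteMeasure m]
    [m.IsOpenPosMeasure] (hVD : VolumeDoubling m) {x : X} {r : ℝ} {i : N} :
    i ∈ hN.nbr hs hVD x r ↔ dist x i < r := by
  simp [IsNet.nbr]

/-- A partition of unity subordinate to the balls of radius `A s` around the points of an `s`-net,
with energies at most `K` times the measures of the balls of radius `s`. -/
structure IsEnergyPartition (𝓔 : EnergyStructure m p) (K A s : ℝ) (N : Set X) (ψ : N → X → ℝ) :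
    Prop where
  energy : ∀ i, HasEnergyLE 𝓔 (ψ i) ((K * (m (Metric.ball (i : X) s)).toReal) ^ (1 / p))
  mem_unit : ∀ i x, 0 ≤ ψ i x ∧ ψ i x ≤ 1
  eq_zero : ∀ (i : N) (x : X), A * s ≤ dist x i → ψ i x = 0
  sum_eq_one : ∀ (x : X) (T : Finset N), (∀ i : N, dist x i < A * s → i ∈ T) → ∑ i ∈ T, ψ i x = 1

theorem CapacityUpperBound.exists_partition [Nontrivial X] [IsLocallyFiniteMeasure m]
    [m.IsOpenPosMeasure] {𝓔 : EnergyStructure m p} {Ψ : ℝ → ℝ} (hcap : CapacityUpperBound 𝓔 Ψ)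
    (hΨ : IsScaleFunction Ψ) (hVD : VolumeDoubling m) :
    ∃ C A s₀ : ℝ, 0 < C ∧ 1 < A ∧ 0 < s₀ ∧ ∀ (s : ℝ) (N : Set X), 0 < s → s < s₀ → IsNet s N →
      ∃ ψ : N → X → ℝ, IsEnergyPartition 𝓔 (C / Ψ s) A s N ψ := by
  classical
  have hp := one_lt_exponent p
  obtain ⟨C, A, s₀, hC, hA, hs₀, hb⟩ := hcap.exists_bump hΨ hVD
  obtain ⟨n, hn⟩ := hVD.exists_card_le (2 * A)
  obtain ⟨D, hD0, hD⟩ := hVD.exists_ball_le (2 * A + 1)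
  refine ⟨(n + 1) ^ p * C * D, A, s₀, by positivity, hA, hs₀, fun s N hs hs0 hN => ?_⟩
  have := hN.countable.to_subtype
  obtain ⟨e, he⟩ := exists_injective_nat N
  choose h hE h01 h1 h0 using fun i : N => hb i s hs hs0
  have hdist : ∀ x i, h i x ≠ 0 → dist x i < A * s := fun x i hi => by
    by_contra hcon
    exact hi (h0 i x (not_lt.1 hcon))
  have hΨs := hΨ.pos hs
  let L : N → Finset N := fun i => hN.nbr hs hVD i (2 * A * s)
  refine ⟨fun i x => max (h i x - ((L i).filter fun j => e j < e i).fold max 0 fun j => h j x) 0,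
    fun i => ?_, fun i x => ?_, fun i x hx => ?_, fun x T hT => ?_⟩
  -- By doubling, c bounds the root energy of the bump at i and of all its neighbours. One bump
  -- minus a maximum of at most n others has root energy at most (n+1)c, whence the factor (n+1)^p.
  · set c := (C * (D * (m (Metric.ball (i : X) s)).toReal) / Ψ s) ^ (1 / p) with hc
    have hc0 : 0 ≤ c := by positivity
    have hle : ∀ j ∈ insert i (L i), HasEnergyLE 𝓔 (h j) c := by
      intro j hj
      refine (hE j).mono ?_
      have hij : dist (i : X) j ≤ 2 * A * s := by
        rcases Finset.mem_insert.1 hj with rfl | hj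
        · rw [dist_self]
          positivity
        · exact ((hN.mem_nbr hs hVD).1 hj).le
      have h3 := hD j i s s hs (by rw [dist_comm]; linarith)
      have h4 : (m (Metric.ball (j : X) s)).toReal ≤ D * (m (Metric.ball (i : X) s)).toReal := by
        have := ENNReal.toReal_mono (ENNReal.mul_ne_top ENNReal.coe_ne_top
          (hVD.ball_lt_top (i : X) s).ne) h3
        simpa using this
      rw [hc]
      gcongr
    have hcard : ((L i).card : ℝ) ≤ n := by
      exact_mod_cast hn s N hs hN i (L i) fun j hj => (hN.mem_nbr hs hVD).1 hj
    have hfold : HasEnergyLE 𝓔 (fun x => ((L i).filter fun j => e j < e i).fold max 0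
        fun j => h j x) (n * c) := by
      refine (hasEnergyLE_fold_max ((L i).filter fun j => e j < e i) (c := fun _ => c)
        fun j hj => hle j (Finset.mem_insert_of_mem (Finset.mem_filter.1 hj).1)).mono ?_
      rw [Finset.sum_const, nsmul_eq_mul]
      refine mul_le_mul_of_nonneg_right (le_trans ?_ hcard) hc0
      exact_mod_cast Finset.card_filter_le _ _
    refine ((hle i (Finset.mem_insert_self _ _)).sub hfold).posPart.mono (le_of_eq ?_)
    have e1 : (n + 1 : ℝ) ^ p * C * D / Ψ s * (m (Metric.ball (i : X) s)).toReal
        = (n + 1 : ℝ) ^ p * (C * (D * (m (Metric.ball (i : X) s)).toReal) / Ψ s) := by ring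
    rw [e1, Real.mul_rpow (by positivity) (by positivity), ← Real.rpow_mul (by positivity),
      mul_one_div_cancel (by positivity), Real.rpow_one, ← hc]
    ring
  · have hf : 0 ≤ ((L i).filter fun j => e j < e i).fold max 0 fun j => h j x :=
      (Finset.le_fold_max _).2 (Or.inl le_rfl)
    exact ⟨le_max_right _ _, max_le (by linarith [(h01 i x).2]) zero_le_one⟩
  · have hf : 0 ≤ ((L i).filter fun j => e j < e i).fold max 0 fun j => h j x :=
      (Finset.le_fold_max _).2 (Or.inl le_rfl)
    rw [h0 i x hx, max_eq_right (by linarith)]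
  · obtain ⟨y, hy, hxy⟩ := hN.cover x
    refine sum_posPart_sub_fold_max_eq_one e he (fun i => h i x) (fun i => h01 i x) L
      (fun i j hi hj => ?_) T (fun j hj => hT j (hdist x j hj)) (k := ⟨y, hy⟩) (h1 _ _ hxy)
    rw [hN.mem_nbr hs hVD]
    have h2 := hdist x i hi
    have h3 := hdist x j hj
    have h4 := dist_triangle_left (i : X) j x
    linarith

end Partition

/-! ### Discrete approximation -/

/-- The oscillation of `u` around the value `a i` on the ball of radius `(2 A + 1) s`. -/
def oscillation {X : Type*} [MetricSpace X] [MeasurableSpace X] (m : Measure X) (p A s : ℝ)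
    (N : Set X) (u : X → ℝ) (a : N → ℝ) (i : N) : ℝ≥0∞ :=
  ∫⁻ x in Metric.ball (i : X) ((2 * A + 1) * s), ENNReal.ofReal (|u x - a i| ^ p) ∂m

/-- B(i, s) lies in both enlarged balls, so there u can be compared with a_i and with a_j
simultaneously. -/
theorem ofReal_abs_sub_rpow_mul_measure_le {X : Type*} [MetricSpace X] [MeasurableSpace X]
    {m : Measure X} {p : ℝ} [Fact (1 < p)] {A s : ℝ} {N : Set X} (hs : 0 < s) (hA : 1 ≤ A) {u : X → ℝ} (hu : Measurable u)
    (a : N → ℝ) {i j : N} (hij : dist (j : X) i < 2 * A * s) :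
    ENNReal.ofReal (|a i - a j| ^ p) * m (Metric.ball (i : X) s) ≤
      ENNReal.ofReal (2 ^ p) * (oscillation m p A s N u a i + oscillation m p A s N u a j) := by
  have hp := one_lt_exponent p
  calc _ = ∫⁻ x in Metric.ball (i : X) s, ENNReal.ofReal (|a i - a j| ^ p) ∂m := by
        rw [lintegral_const, Measure.restrict_apply_univ]
    _ ≤ ∫⁻ x in Metric.ball (i : X) s, ENNReal.ofReal (2 ^ p) *
          (ENNReal.ofReal (|u x - a i| ^ p) + ENNReal.ofReal (|u x - a j| ^ p)) ∂m := by
        refine lintegral_mono fun x => ?_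
        rw [abs_sub_comm (u x), abs_sub_comm (u x)]
        exact ofReal_abs_sub_rpow_le (by positivity) _ _ _
    _ = ENNReal.ofReal (2 ^ p) * (∫⁻ x in Metric.ball (i : X) s, ENNReal.ofReal (|u x - a i| ^ p) ∂m
          + ∫⁻ x in Metric.ball (i : X) s, ENNReal.ofReal (|u x - a j| ^ p) ∂m) := by
        rw [lintegral_const_mul' _ _ ENNReal.ofReal_ne_top, lintegral_add_left (by fun_prop)]
    _ ≤ _ := by
        gcongr
        · refine lintegral_mono_set (Metric.ball_subset_ball ?_)
          nlinarith
        · refine lintegral_mono_set (Metric.ball_subset_ball' ?_)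
          rw [dist_comm]
          linarith

section Approximation

variable {X : Type*} [MetricSpace X] [MeasurableSpace X] [BorelSpace X] {m : Measure X} {p : ℝ}
  [Fact (1 < p)] [IsLocallyFiniteMeasure m] [m.IsOpenPosMeasure]

/-- Double counting: being neighbours is symmetric, so each term is counted at most n times. -/
theorem tsum_sum_nbr_le (hVD : VolumeDoubling m) {s : ℝ} (hs : 0 < s) {N : Set X} (hN : IsNet s N)
    {r : ℝ} {n : ℕ} (hn : ∀ (x : X) (T : Finset N), (∀ i ∈ T, dist x i < r) → T.card ≤ n)
    (g : N → ℝ≥0∞) :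
    ∑' j : N, ∑ i ∈ hN.nbr hs hVD j r, g i ≤ n * ∑' i, g i := by
  classical
  have h1 : ∀ j : N, ∑ i ∈ hN.nbr hs hVD j r, g i
      = ∑' i, if i ∈ hN.nbr hs hVD j r then g i else 0 := by
    intro j
    rw [tsum_eq_sum (s := hN.nbr hs hVD j r) fun i hi => if_neg hi]
    exact Finset.sum_congr rfl fun i hi => (if_pos hi).symm
  simp only [h1]
  rw [ENNReal.tsum_comm, ← ENNReal.tsum_mul_left]
  refine ENNReal.tsum_le_tsum fun i => ?_
  have h2 : ∀ j : N, (i ∈ hN.nbr hs hVD j r) ↔ j ∈ hN.nbr hs hVD i r := by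
    intro j
    rw [hN.mem_nbr, hN.mem_nbr, dist_comm]
  simp only [h2]
  rw [tsum_eq_sum (s := hN.nbr hs hVD i r) fun j hj => if_neg hj,
    Finset.sum_congr rfl fun j hj => if_pos hj, Finset.sum_const, nsmul_eq_mul]
  gcongr
  exact hn i _ fun j hj => (hN.mem_nbr hs hVD).1 hj

variable {𝓔 : EnergyStructure m p} {K A s : ℝ} {N : Set X} {ψ : N → X → ℝ}

theorem IsEnergyPartition.sum_eq (hψ : IsEnergyPartition 𝓔 K A s N ψ) (hA : 1 ≤ A)
    (hVD : VolumeDoubling m) (hs : 0 < s) (hN : IsNet s N) (a : N → ℝ) (S : Finset N)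
    (ha : ∀ i ∉ S, a i = 0) (c : ℝ) (j : N) {x : X} (hx : dist x j < s) :
    ∑ i ∈ S, a i * ψ i x - c = ∑ i ∈ hN.nbr hs hVD j (2 * A * s), (a i - c) * ψ i x := by
  classical
  have h0 : ∀ i ∉ hN.nbr hs hVD j (2 * A * s), ψ i x = 0 := by
    intro i hi
    refine hψ.eq_zero i x ?_
    rw [hN.mem_nbr, not_lt] at hi
    have := dist_triangle_left (j : X) i x
    nlinarith
  have h1 : ∑ i ∈ S, a i * ψ i x = ∑ i ∈ S ∪ hN.nbr hs hVD j (2 * A * s), a i * ψ i x :=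
    Finset.sum_subset Finset.subset_union_left fun i _ hi => by rw [ha i hi, zero_mul]
  have h2 : ∑ i ∈ hN.nbr hs hVD j (2 * A * s), a i * ψ i x
      = ∑ i ∈ S ∪ hN.nbr hs hVD j (2 * A * s), a i * ψ i x :=
    Finset.sum_subset Finset.subset_union_right fun i _ hi => by rw [h0 i hi, mul_zero]
  have h3 : ∑ i ∈ hN.nbr hs hVD j (2 * A * s), ψ i x = 1 := by
    refine hψ.sum_eq_one x _ fun i hi => ?_
    by_contra hcon
    rw [hN.mem_nbr, not_lt] at hcon
    have := dist_triangle_left (j : X) i x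
    nlinarith
  simp only [sub_mul, Finset.sum_sub_distrib, ← Finset.mul_sum]
  rw [h1, h2, h3, mul_one]

/-- On B(j, s) the function w equals a_j plus v = ∑ (a_i - a_j) ψ_i over the neighbours of j.
Locality replaces the energy of w on this ball by that of v, which is at most its total energy; the
power-mean inequality over at most n terms gives n^(p-1). -/
theorem IsEnergyPartition.local_energy_le [LocallyCompactSpace X] [SecondCountableTopology X]
    (hψ : IsEnergyPartition 𝓔 K A s N ψ) (hK : 0 ≤ K) (hA : 1 ≤ A)
    (hVD : VolumeDoubling m) (hs : 0 < s) (hN : IsNet s N)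
    {n : ℕ} (hn : ∀ (x : X) (T : Finset N), (∀ i ∈ T, dist x i < (2 * A + 1) * s) → T.card ≤ n)
    (a : N → ℝ) (S : Finset N) (ha : ∀ i ∉ S, a i = 0) (w : 𝓔.F)
    (hw : w.1 =ᵐ[m] fun x => ∑ i ∈ S, a i * ψ i x) (j : N) :
    (𝓔.Γ w : Measure X) (Metric.ball (j : X) s) ≤ ENNReal.ofReal ((n : ℝ) ^ (p - 1) * K) *
      ∑ i ∈ hN.nbr hs hVD j (2 * A * s),
        ENNReal.ofReal (|a i - a j| ^ p) * m (Metric.ball (i : X) s) := by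
  have hp := one_lt_exponent p
  set L := hN.nbr hs hVD (j : X) (2 * A * s) with hL
  have hLn : L.card ≤ n := hn j L fun i hi => by
    have := (hN.mem_nbr hs hVD).1 hi
    linarith
  set c : N → ℝ := fun i => (K * (m (Metric.ball (i : X) s)).toReal) ^ (1 / p) with hc
  have hc0 : ∀ i, 0 ≤ c i := fun i => by positivity
  obtain ⟨v, hv, hvE⟩ := HasEnergyLE.sum L fun i _ => (hψ.energy i).const_mul (a i - a j)
  -- A crude bound suffices: locality off C_c(X) is available for bounded functions, with no
  -- dependence on the bound.
  have hbd : ∀ (T : Finset N) (b : N → ℝ) (x : X), |∑ i ∈ T, b i * ψ i x| ≤ ∑ i ∈ T, |b i| := by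
    intro T b x
    refine (Finset.abs_sum_le_sum_abs _ _).trans (Finset.sum_le_sum fun i _ => ?_)
    rw [abs_mul, abs_of_nonneg (hψ.mem_unit i x).1]
    exact mul_le_of_le_one_right (abs_nonneg _) (hψ.mem_unit i x).2
  have hB : MeasurableSet (Metric.ball (j : X) s) := Metric.isOpen_ball.measurableSet
  have hwv : (w - v).1 = w.1 - v.1 := rfl
  have h0 : (𝓔.Γ (w - v) : Measure X) (Metric.ball (j : X) s) = 0 := by
    refine energyMeasure_eq_zero_of_const 𝓔 (w - v)
      (N := ∑ i ∈ S, |a i| + ∑ i ∈ L, |a i - a j|) ?_ Metric.isOpen_ball (c := a j) ?_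
    · rw [hwv]
      filter_upwards [Lp.coeFn_sub w.1 v.1, hw, hv] with x h1 h2 h3
      rw [h1, Pi.sub_apply, h2, h3]
      exact (abs_sub _ _).trans (add_le_add (hbd _ _ _) (hbd _ _ _))
    · rw [hwv]
      filter_upwards [Lp.coeFn_sub w.1 v.1, hw, hv] with x h1 h2 h3 hx
      rw [h1, Pi.sub_apply, h2, h3, ← hψ.sum_eq hA hVD hs hN a S ha (a j) j hx]
      ring
  rw [← localSeminorm_eq_zero_iff 𝓔 hB] at h0
  have h1 : localSeminorm 𝓔 hB w ≤ ∑ i ∈ L, |a i - a j| * c i := by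
    have := map_add_le_add (localSeminorm 𝓔 hB) (w - v) v
    rw [sub_add_cancel, h0, zero_add] at this
    exact this.trans ((localSeminorm_le_energy 𝓔 hB v).trans hvE)
  have h2 : (𝓔.Γ w (Metric.ball (j : X) s) : ℝ) ≤ (n : ℝ) ^ (p - 1) * K *
      ∑ i ∈ L, |a i - a j| ^ p * (m (Metric.ball (i : X) s)).toReal := by
    rw [localSeminorm_apply] at h1
    calc (𝓔.Γ w (Metric.ball (j : X) s) : ℝ)
        = ((𝓔.Γ w (Metric.ball (j : X) s) : ℝ) ^ (1 / p)) ^ p := by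
          rw [← Real.rpow_mul (NNReal.coe_nonneg _), one_div_mul_cancel (by positivity),
            Real.rpow_one]
      _ ≤ (∑ i ∈ L, |a i - a j| * c i) ^ p := by gcongr
      _ ≤ (L.card : ℝ) ^ (p - 1) * ∑ i ∈ L, (|a i - a j| * c i) ^ p :=
          Real.rpow_sum_le_const_mul_sum_rpow_of_nonneg _ hp.le
            fun i _ => mul_nonneg (abs_nonneg _) (hc0 i)
      _ ≤ (n : ℝ) ^ (p - 1) * ∑ i ∈ L, (|a i - a j| * c i) ^ p := by
          have : 0 ≤ ∑ i ∈ L, (|a i - a j| * c i) ^ p := Finset.sum_nonneg fun i _ =>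
            Real.rpow_nonneg (mul_nonneg (abs_nonneg _) (hc0 i)) _
          have h3 : 0 ≤ p - 1 := by linarith
          gcongr
      _ = _ := by
          rw [mul_assoc, Finset.mul_sum (a := K)]
          congr 1
          refine Finset.sum_congr rfl fun i _ => ?_
          rw [Real.mul_rpow (abs_nonneg _) (hc0 i), hc, ← Real.rpow_mul (by positivity),
            one_div_mul_cancel (by positivity), Real.rpow_one]
          ring
  rw [← FiniteMeasure.ennreal_coeFn_eq_coeFn_toMeasure, ← ENNReal.ofReal_coe_nnreal]
  refine (ENNReal.ofReal_le_ofReal h2).trans (le_of_eq ?_)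
  rw [ENNReal.ofReal_mul (by positivity), ENNReal.ofReal_sum_of_nonneg fun i _ => by positivity]
  congr 1
  refine Finset.sum_congr rfl fun i _ => ?_
  rw [ENNReal.ofReal_mul (by positivity), ENNReal.ofReal_toReal (hVD.ball_lt_top _ _).ne]

theorem IsEnergyPartition.energy_le [LocallyCompactSpace X] [SecondCountableTopology X]
    (hψ : IsEnergyPartition 𝓔 K A s N ψ) (hK : 0 ≤ K) (hA : 1 ≤ A)
    (hVD : VolumeDoubling m) (hs : 0 < s) (hN : IsNet s N)
    {n : ℕ} (hn : ∀ (x : X) (T : Finset N), (∀ i ∈ T, dist x i < (2 * A + 1) * s) → T.card ≤ n)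
    (a : N → ℝ) (S : Finset N) (ha : ∀ i ∉ S, a i = 0) (w : 𝓔.F)
    (hw : w.1 =ᵐ[m] fun x => ∑ i ∈ S, a i * ψ i x) {u : X → ℝ} (hu : Measurable u) :
    (𝓔.E w : ℝ≥0∞) ≤ ENNReal.ofReal ((n : ℝ) ^ (p - 1) * K * 2 ^ p * (2 * n)) *
      ∑' i, oscillation m p A s N u a i := by
  have hp := one_lt_exponent p
  have := hN.countable.to_subtype
  set q := oscillation m p A s N u a
  have hn' : ∀ (x : X) (T : Finset N), (∀ i ∈ T, dist x i < 2 * A * s) → T.card ≤ n :=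
    fun x T hT => hn x T fun i hi => (hT i hi).trans (by linarith)
  set D := ENNReal.ofReal ((n : ℝ) ^ (p - 1) * K)
  calc (𝓔.E w : ℝ≥0∞) = (𝓔.Γ w : Measure X) univ := by
        rw [𝓔.measure_univ, FiniteMeasure.ennreal_coeFn_eq_coeFn_toMeasure]
    _ ≤ ∑' j : N, (𝓔.Γ w : Measure X) (Metric.ball (j : X) s) := by
        simpa using lintegral_le_tsum_ball hN (𝓔.Γ w : Measure X) fun _ => 1
    _ ≤ ∑' j : N, D * ∑ i ∈ hN.nbr hs hVD j (2 * A * s), ENNReal.ofReal (2 ^ p) * (q i + q j) := by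
        refine ENNReal.tsum_le_tsum fun j => ?_
        refine (hψ.local_energy_le hK hA hVD hs hN hn a S ha w hw j).trans ?_
        refine mul_le_mul_right (Finset.sum_le_sum fun i hi => ?_) _
        exact ofReal_abs_sub_rpow_mul_measure_le hs hA hu a ((hN.mem_nbr hs hVD).1 hi)
    _ = D * ENNReal.ofReal (2 ^ p) * (∑' j : N, ∑ i ∈ hN.nbr hs hVD j (2 * A * s), q i
          + ∑' j : N, ∑ i ∈ hN.nbr hs hVD j (2 * A * s), q j) := by
        rw [← ENNReal.tsum_add, ← ENNReal.tsum_mul_left]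
        refine tsum_congr fun j => ?_
        rw [← Finset.mul_sum, ← Finset.sum_add_distrib, ← mul_assoc]
    _ ≤ D * ENNReal.ofReal (2 ^ p) * (n * ∑' i, q i + n * ∑' i, q i) := by
        gcongr
        · exact tsum_sum_nbr_le hVD hs hN hn' q
        · rw [← ENNReal.tsum_mul_left]
          refine ENNReal.tsum_le_tsum fun j => ?_
          rw [Finset.sum_const, nsmul_eq_mul]
          gcongr
          exact hn' j _ fun i hi => (hN.mem_nbr hs hVD).1 hi
    _ = _ := by
        rw [ENNReal.ofReal_mul (by positivity), ENNReal.ofReal_mul (by positivity),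
          ENNReal.ofReal_mul (by norm_num : (0 : ℝ) ≤ 2), ENNReal.ofReal_natCast,
          ENNReal.ofReal_ofNat]
        ring

/-- Near j the difference w - u is ∑ (a_i - u) ψ_i over neighbours, so it is controlled by the same
oscillations as the energy, without the factor `K`. -/
theorem IsEnergyPartition.lintegral_sub_le [SecondCountableTopology X]
    (hψ : IsEnergyPartition 𝓔 K A s N ψ) (hA : 1 ≤ A)
    (hVD : VolumeDoubling m) (hs : 0 < s) (hN : IsNet s N)
    {n : ℕ} (hn : ∀ (x : X) (T : Finset N), (∀ i ∈ T, dist x i < (2 * A + 1) * s) → T.card ≤ n)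
    (a : N → ℝ) (S : Finset N) (ha : ∀ i ∉ S, a i = 0) {u : X → ℝ} (hu : Measurable u) :
    ∫⁻ x, ENNReal.ofReal (|∑ i ∈ S, a i * ψ i x - u x| ^ p) ∂m ≤
      ENNReal.ofReal ((n : ℝ) ^ (p - 1) * n) * ∑' i, oscillation m p A s N u a i := by
  have hp := one_lt_exponent p
  have hn' : ∀ (x : X) (T : Finset N), (∀ i ∈ T, dist x i < 2 * A * s) → T.card ≤ n :=
    fun x T hT => hn x T fun i hi => (hT i hi).trans (by linarith)
  have hpt : ∀ (j : N) (x : X), dist x j < s →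
      ENNReal.ofReal (|∑ i ∈ S, a i * ψ i x - u x| ^ p) ≤ ENNReal.ofReal ((n : ℝ) ^ (p - 1)) *
        ∑ i ∈ hN.nbr hs hVD j (2 * A * s), ENNReal.ofReal (|u x - a i| ^ p) := by
    intro j x hx
    set L := hN.nbr hs hVD (j : X) (2 * A * s)
    have hLn : L.card ≤ n := hn' j L fun i hi => (hN.mem_nbr hs hVD).1 hi
    rw [hψ.sum_eq hA hVD hs hN a S ha (u x) j hx,
      ← ENNReal.ofReal_sum_of_nonneg fun i _ => by positivity, ← ENNReal.ofReal_mul (by positivity)]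
    refine ENNReal.ofReal_le_ofReal ?_
    have h3 : 0 ≤ p - 1 := by linarith
    calc |∑ i ∈ L, (a i - u x) * ψ i x| ^ p ≤ (∑ i ∈ L, |u x - a i|) ^ p := by
          gcongr
          refine (Finset.abs_sum_le_sum_abs _ _).trans (Finset.sum_le_sum fun i _ => ?_)
          rw [abs_mul, abs_of_nonneg (hψ.mem_unit i x).1, abs_sub_comm]
          exact mul_le_of_le_one_right (abs_nonneg _) (hψ.mem_unit i x).2
      _ ≤ (L.card : ℝ) ^ (p - 1) * ∑ i ∈ L, |u x - a i| ^ p :=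
          Real.rpow_sum_le_const_mul_sum_rpow _ _ hp.le
      _ ≤ _ := by gcongr
  calc _ ≤ ∑' j : N, ∫⁻ x in Metric.ball (j : X) s,
          ENNReal.ofReal (|∑ i ∈ S, a i * ψ i x - u x| ^ p) ∂m := lintegral_le_tsum_ball hN m _
    _ ≤ ∑' j : N, ENNReal.ofReal ((n : ℝ) ^ (p - 1)) *
          ∑ i ∈ hN.nbr hs hVD j (2 * A * s), oscillation m p A s N u a i := by
        refine ENNReal.tsum_le_tsum fun j => ?_
        refine (setLIntegral_mono' Metric.isOpen_ball.measurableSet (hpt j)).trans ?_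
        rw [lintegral_const_mul' _ _ ENNReal.ofReal_ne_top, lintegral_finsetSum _ (by fun_prop)]
        gcongr with i hi
        refine lintegral_mono_set (Metric.ball_subset_ball' ?_)
        have := (hN.mem_nbr hs hVD).1 hi
        linarith
    _ ≤ _ := by
        rw [ENNReal.tsum_mul_left, ENNReal.ofReal_mul (by positivity), ENNReal.ofReal_natCast,
          mul_assoc (ENNReal.ofReal _)]
        exact mul_le_mul_right (tsum_sum_nbr_le hVD hs hN hn' _) _

end Approximation

/-! ### The lower bound for the Besov functionals -/

/-- Jensen's inequality for t ↦ t^p on the normalized measure of B. -/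
theorem ofReal_abs_setAverage_sub_rpow_le {X : Type*} [MeasurableSpace X] {m : Measure X} {p : ℝ}
    [Fact (1 < p)] (u : Lp ℝ (ENNReal.ofReal p) m) {B : Set X} (hB0 : m B ≠ 0) (hBt : m B ≠ ∞)
    (c : ℝ) :
    ENNReal.ofReal (|⨍ x in B, u x ∂m - c| ^ p) ≤
      (∫⁻ x in B, ENNReal.ofReal (|u x - c| ^ p) ∂m) / m B := by
  have hp := one_lt_exponent p
  have hfin : IsFiniteMeasure (m.restrict B) := isFiniteMeasure_restrict.2 hBt
  have hu : MemLp u (ENNReal.ofReal p) (m.restrict B) := (Lp.memLp u).restrict B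
  have hf : MemLp (fun x => u x - c) (ENNReal.ofReal p) (m.restrict B) := hu.sub (memLp_const c)
  have h1 : (1 : ℝ≥0∞) ≤ ENNReal.ofReal p := ENNReal.one_le_ofReal.2 hp.le
  have hui : IntegrableOn u B m := hu.integrable h1
  have hfi : IntegrableOn (fun x => |u x - c|) B m := (hf.integrable h1).abs
  have hfp : IntegrableOn (fun x => |u x - c| ^ p) B m := by
    have := hf.integrable_norm_rpow (by simpa using (zero_lt_one.trans hp)) ENNReal.ofReal_ne_top
    rw [ENNReal.toReal_ofReal (by positivity)] at this
    exact this
  rw [← ofReal_setAverage hfp (Eventually.of_forall fun x => by positivity)]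
  refine ENNReal.ofReal_le_ofReal ?_
  have h2 : |⨍ x in B, u x ∂m - c| ≤ ⨍ x in B, |u x - c| ∂m := by
    have e : ⨍ x in B, u x ∂m - c = ⨍ x in B, (u x - c) ∂m := by
      rw [setAverage_eq, setAverage_eq, integral_sub hui (integrable_const c), smul_sub,
        setIntegral_const, smul_smul, inv_mul_cancel₀, one_smul]
      exact (ENNReal.toReal_pos hB0 hBt).ne'
    rw [e, setAverage_eq, setAverage_eq, smul_eq_mul, smul_eq_mul, abs_mul,
      abs_of_nonneg (by positivity)]
    gcongr
    exact abs_integral_le_integral_abs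
  calc |⨍ x in B, u x ∂m - c| ^ p ≤ (⨍ x in B, |u x - c| ∂m) ^ p := by gcongr
    _ ≤ _ := (convexOn_rpow hp.le).map_set_average_le
        (Real.continuous_rpow_const (by positivity)).continuousOn isClosed_Ici hB0 hBt
        (Eventually.of_forall fun x => mem_Ici.2 (abs_nonneg _)) hfi hfp

section Lower

variable {X : Type*} [MetricSpace X] [MeasurableSpace X] [BorelSpace X] {m : Measure X} {p : ℝ}
  [Fact (1 < p)] [IsLocallyFiniteMeasure m] [m.IsOpenPosMeasure]

theorem lintegral_ball_abs_sub_average_le (hVD : VolumeDoubling m) {D : ℝ≥0}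
    (hD : ∀ (x y : X) (r R : ℝ), 0 < r → dist x y + R ≤ 3 * r →
      m (Metric.ball x R) ≤ D * m (Metric.ball y r))
    (u : Lp ℝ (ENNReal.ofReal p) m) {r : ℝ} (hr : 0 < r) (z : X) :
    ∫⁻ y in Metric.ball z r, ENNReal.ofReal (|u y - ⨍ x in Metric.ball z r, u x ∂m| ^ p) ∂m ≤
      D * ∫⁻ y in Metric.ball z r,
        ∫⁻ x, ENNReal.ofReal (|u x - u y| ^ p) * ballKernel m (2 * r) x y ∂m ∂m := by
  have hB0 : m (Metric.ball z r) ≠ 0 := (Metric.measure_ball_pos m z hr).ne'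
  have hBt : m (Metric.ball z r) ≠ ∞ := (hVD.ball_lt_top z r).ne
  rw [← lintegral_const_mul' _ _ ENNReal.coe_ne_top]
  refine setLIntegral_mono' Metric.isOpen_ball.measurableSet fun y hy => ?_
  rw [abs_sub_comm]
  refine (ofReal_abs_setAverage_sub_rpow_le u hB0 hBt (u y)).trans ?_
  rw [div_eq_mul_inv, ← lintegral_mul_const' _ _ (ENNReal.inv_ne_top.2 hB0),
    ← lintegral_const_mul' _ _ ENNReal.coe_ne_top]
  refine le_trans (setLIntegral_mono' Metric.isOpen_ball.measurableSet fun x hx => ?_)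
    (setLIntegral_le_lintegral (Metric.ball z r) _)
  rw [Metric.mem_ball] at hx hy
  have hxy : x ∈ Metric.ball y (2 * r) := by
    rw [Metric.mem_ball]
    linarith [dist_triangle_right x y z]
  rw [ballKernel, indicator_of_mem hxy, one_div, mul_left_comm]
  gcongr
  have h1 := hD y z r (2 * r) hr (by linarith)
  have h2 : m (Metric.ball y (2 * r)) ≠ 0 := (Metric.measure_ball_pos m y (by positivity)).ne'
  have h3 : m (Metric.ball y (2 * r)) ≠ ∞ := (hVD.ball_lt_top _ _).ne
  rw [← div_eq_mul_inv, ENNReal.le_div_iff_mul_le (Or.inl h2) (Or.inl h3), mul_comm,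
    ← div_eq_mul_inv]
  exact ENNReal.div_le_of_le_mul h1

/-- If the ball functional of `u` at a small scale `t` is at most `M Ψ(t)`, then `u` is
approximated in `L^p` by a function of the domain with controlled energy. -/
theorem CapacityUpperBound.exists_approximation [LocallyCompactSpace X]
    [TopologicalSpace.SeparableSpace X] [Nontrivial X] {𝓔 : EnergyStructure m p} {Ψ : ℝ → ℝ}
    (hcap : CapacityUpperBound 𝓔 Ψ) (hΨ : IsScaleFunction Ψ) (hVD : VolumeDoubling m) :
    ∃ C t₀ : ℝ, 0 < C ∧ 0 < t₀ ∧ ∀ (u : Lp ℝ (ENNReal.ofReal p) m) (M t : ℝ), 0 < t → t < t₀ →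
      0 ≤ M → ballFunctional m p t u ≤ ENNReal.ofReal (M * Ψ t) → ∃ w : 𝓔.F,
        (𝓔.E w : ℝ≥0∞) ≤ ENNReal.ofReal (C * (M + 1)) ∧
        ∫⁻ x, ENNReal.ofReal (|w.1 x - u x| ^ p) ∂m ≤ ENNReal.ofReal (C * (M + 1) * Ψ t) := by
  classical
  have hp := one_lt_exponent p
  have : SecondCountableTopology X := UniformSpace.secondCountable_of_separable X
  obtain ⟨C, A, s₀, hC, hA, hs₀, hpart⟩ := hcap.exists_partition hΨ hVD
  obtain ⟨n, hn⟩ := hVD.exists_card_le (2 * A + 1)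
  obtain ⟨D, hD0, hD⟩ := hVD.exists_ball_le 3
  -- Two points of a ball of radius (2A+1)s are at distance less than lam · s = t, so its
  -- oscillation is seen by the ball functional at scale t.
  set lam := 2 * (2 * A + 1) with hlam
  have hlam1 : 1 ≤ lam := by linarith
  obtain ⟨C', hC'0, hC'⟩ := hΨ.exists_le_mul hlam1
  set c₁ := (n : ℝ) ^ (p - 1) * (C * C') * 2 ^ p * (2 * n) * (D * n + 1) with hc₁
  set c₂ := (n : ℝ) ^ (p - 1) * n * (D * n + 1) with hc₂
  have hc₁0 : 0 ≤ c₁ := by positivity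
  have hc₂0 : 0 ≤ c₂ := by positivity
  refine ⟨c₁ + c₂ + 1, lam * s₀, by positivity, by positivity, fun u M t ht htt hM hu => ?_⟩
  have hlam0 : 0 < lam := by positivity
  set s := t / lam with hs_def
  have hs : 0 < s := by positivity
  have hts : t = lam * s := by rw [hs_def]; field_simp
  have hss : s < s₀ := by rw [hs_def, div_lt_iff₀ hlam0, mul_comm]; exact htt
  obtain ⟨N, hN⟩ := exists_isNet (X := X) hs
  obtain ⟨ψ, hψ⟩ := hpart s N hs hss hN
  have hn := hn s N hs hN
  have hΨs := hΨ.pos hs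
  have hΨt := hΨ.pos ht
  have hum : Measurable u := (Lp.stronglyMeasurable u).measurable
  have hr : 0 < (2 * A + 1) * s := by positivity
  set avg : N → ℝ := fun i => ⨍ x in Metric.ball (i : X) ((2 * A + 1) * s), u x ∂m
  set b : N → ℝ≥0∞ := fun i =>
    ∫⁻ x in Metric.ball (i : X) ((2 * A + 1) * s), ENNReal.ofReal (|u x| ^ p) ∂m
  have hbt : ∑' i, b i ≠ ∞ := by
    refine ne_top_of_le_ne_top ?_ (tsum_lintegral_ball_le hN hn m (by fun_prop))
    exact ENNReal.mul_ne_top (ENNReal.natCast_ne_top n) (lintegral_abs_rpow_lt_top u).ne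
  -- Only finite sums are known to lie in the domain. As ∑ b_i < ∞, setting the coefficients to 0
  -- off a large finite `S` costs at most Ψ(t), the source of the 1 in M + 1.
  obtain ⟨S, hS⟩ := ((ENNReal.tendsto_tsum_compl_atTop_zero hbt).eventually
    (gt_mem_nhds (ENNReal.ofReal_pos.2 hΨt))).exists
  set a : N → ℝ := fun i => if i ∈ S then avg i else 0 with ha_def
  have ha : ∀ i ∉ S, a i = 0 := fun i hi => if_neg hi
  have hQ : ∑' i, oscillation m p A s N u a i ≤ ENNReal.ofReal ((D * n + 1) * (M + 1) * Ψ t) := by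
    set G : X → ℝ≥0∞ := fun y => ∫⁻ x, ENNReal.ofReal (|u x - u y| ^ p) * ballKernel m t x y ∂m
    have hGm : Measurable G :=
      ((measurable_difference hum).mul (measurable_ballKernel_prod t)).lintegral_prod_right'
    calc ∑' i, oscillation m p A s N u a i
        ≤ ∑' i : N, (D * ∫⁻ y in Metric.ball (i : X) ((2 * A + 1) * s), G y ∂m
            + ({i | i ∉ S} : Set N).indicator b i) := by
          refine ENNReal.tsum_le_tsum fun i => ?_
          by_cases hi : i ∈ S
          · refine le_add_right ?_
            have h1 := lintegral_ball_abs_sub_average_le hVD hD u hr (i : X)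
            have e : 2 * ((2 * A + 1) * s) = t := by rw [hts, hlam]; ring
            rw [e] at h1
            simpa only [oscillation, ha_def, if_pos hi] using h1
          · refine le_add_left ?_
            rw [indicator_of_mem (by exact hi)]
            simp only [oscillation, ha_def, if_neg hi, sub_zero]
            exact le_rfl
      _ = D * ∑' i : N, ∫⁻ y in Metric.ball (i : X) ((2 * A + 1) * s), G y ∂m
            + ∑' i : {i // i ∉ S}, b i := by
          rw [ENNReal.tsum_add, ENNReal.tsum_mul_left, ← tsum_subtype]
          rfl
      _ ≤ D * (n * ENNReal.ofReal (M * Ψ t)) + ENNReal.ofReal (Ψ t) := by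
          refine add_le_add (mul_le_mul_right ?_ _) hS.le
          exact (tsum_lintegral_ball_le hN hn m hGm.aemeasurable).trans (mul_le_mul_right hu _)
      _ = ENNReal.ofReal (D * (n * (M * Ψ t)) + Ψ t) := by
          rw [ENNReal.ofReal_add (by positivity) (by positivity),
            ENNReal.ofReal_mul NNReal.zero_le_coe, ENNReal.ofReal_mul (Nat.cast_nonneg n),
            ENNReal.ofReal_coe_nnreal, ENNReal.ofReal_natCast]
      _ ≤ _ := by
          refine ENNReal.ofReal_le_ofReal ?_
          have h1 : 0 ≤ (D : ℝ) * n * Ψ t := by positivity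
          have h2 : 0 ≤ M * Ψ t := by positivity
          nlinarith
  obtain ⟨w, hw, -⟩ := HasEnergyLE.sum S fun i _ => (hψ.energy i).const_mul (a i)
  refine ⟨w, ?_, ?_⟩
  · have hK : 0 ≤ C / Ψ s := by positivity
    refine (hψ.energy_le hK hA.le hVD hs hN hn a S ha w hw hum).trans ?_
    refine (mul_le_mul_right hQ _).trans ?_
    rw [← ENNReal.ofReal_mul (by positivity)]
    refine ENNReal.ofReal_le_ofReal ?_
    have h1 : C / Ψ s * Ψ t ≤ C * C' := by
      rw [div_mul_eq_mul_div, div_le_iff₀ hΨs, mul_assoc]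
      gcongr
      rw [hts]
      exact hC' s hs
    calc (n : ℝ) ^ (p - 1) * (C / Ψ s) * 2 ^ p * (2 * n) * ((D * n + 1) * (M + 1) * Ψ t)
        = (n : ℝ) ^ (p - 1) * (C / Ψ s * Ψ t) * 2 ^ p * (2 * n) * (D * n + 1) * (M + 1) := by ring
      _ ≤ c₁ * (M + 1) := by
          rw [hc₁]
          gcongr
      _ ≤ _ := by
          gcongr
          linarith
  · have h2 : ∫⁻ x, ENNReal.ofReal (|w.1 x - u x| ^ p) ∂m
        = ∫⁻ x, ENNReal.ofReal (|∑ i ∈ S, a i * ψ i x - u x| ^ p) ∂m := by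
      refine lintegral_congr_ae ?_
      filter_upwards [hw] with x hx
      rw [hx]
    rw [h2]
    refine (hψ.lintegral_sub_le hA.le hVD hs hN hn a S ha hum).trans ?_
    refine (mul_le_mul_right hQ _).trans ?_
    rw [← ENNReal.ofReal_mul (by positivity)]
    refine ENNReal.ofReal_le_ofReal ?_
    calc (n : ℝ) ^ (p - 1) * n * ((D * n + 1) * (M + 1) * Ψ t) = c₂ * (M + 1) * Ψ t := by
          rw [hc₂]
          ring
      _ ≤ _ := by
          gcongr
          linarith

theorem tendsto_Lp_of_lintegral {X : Type*} [MeasurableSpace X] {m : Measure X} {p : ℝ}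
    [Fact (1 < p)] (w : ℕ → Lp ℝ (ENNReal.ofReal p) m) (u : Lp ℝ (ENNReal.ofReal p) m)
    (h : Tendsto (fun k => ∫⁻ x, ENNReal.ofReal (|w k x - u x| ^ p) ∂m) atTop (𝓝 0)) :
    Tendsto w atTop (𝓝 u) := by
  have hp := one_lt_exponent p
  rw [Lp.tendsto_Lp_iff_tendsto_eLpNorm']
  have h1 : ∀ k, eLpNorm (⇑(w k) - ⇑u) (ENNReal.ofReal p) m
      = (∫⁻ x, ENNReal.ofReal (|w k x - u x| ^ p) ∂m) ^ (1 / p) := by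
    intro k
    rw [eLpNorm_eq_lintegral_rpow_enorm_toReal (by simpa using (zero_lt_one.trans hp))
      ENNReal.ofReal_ne_top, ENNReal.toReal_ofReal (by positivity)]
    congr 1
    refine lintegral_congr fun x => ?_
    rw [← ENNReal.ofReal_rpow_of_nonneg (abs_nonneg _) (by positivity), ← Real.norm_eq_abs,
      ofReal_norm, Pi.sub_apply]
  simp only [h1]
  have h2 := (ENNReal.continuous_rpow_const (y := 1 / p)).tendsto 0
  rw [ENNReal.zero_rpow_of_pos (by positivity)] at h2
  exact h2.comp h

/-- A function whose Besov functionals have finite lower limit belongs to the domain. -/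
theorem mem_domain_of_liminf_besovFunctional [LocallyCompactSpace X]
    [TopologicalSpace.SeparableSpace X] [Nontrivial X] {𝓔 : EnergyStructure m p} {Ψ : ℝ → ℝ}
    (hcap : CapacityUpperBound 𝓔 Ψ) (hΨ : IsScaleFunction Ψ) (hVD : VolumeDoubling m)
    {ρ : ℝ → X → X → ℝ≥0} {C : ℝ} (hC : 0 < C) (hρ : KernelLower m Ψ ρ C)
    (u : Lp ℝ (ENNReal.ofReal p) m)
    (h : liminf (fun ε => besovFunctional m p Ψ (ρ ε) u) (𝓝[>] 0) < ∞) : u ∈ 𝓔.F := by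
  have hp := one_lt_exponent p
  have : SecondCountableTopology X := UniformSpace.secondCountable_of_separable X
  obtain ⟨M, hM, hsc⟩ := exists_ballFunctional_le_of_liminf (zero_lt_one.trans hp) hΨ hC hρ
    (Lp.stronglyMeasurable u).measurable h
  obtain ⟨K, t₀, hK, ht₀, happ⟩ := hcap.exists_approximation hΨ hVD
  have hseq : ∀ k : ℕ, ∃ w : 𝓔.F, (𝓔.E w : ℝ≥0∞) ≤ ENNReal.ofReal (K * (M + 1)) ∧
      ∫⁻ x, ENNReal.ofReal (|w.1 x - u x| ^ p) ∂m
        ≤ ENNReal.ofReal (K * (M + 1) * (1 / ((k : ℝ) + 1))) := by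
    intro k
    -- Choosing Ψ(δ) = 1/(k+1) makes the L^p error of order Ψ(t) tend to 0, while the energy bound
    -- does not depend on k.
    obtain ⟨δ, hδ, hδk⟩ := hΨ.bijOn.surjOn (mem_Ioi.2
      (Nat.one_div_pos_of_nat (α := ℝ) (n := k)))
    obtain ⟨t, ht, htle, hB⟩ := hsc (min δ (t₀ / 2)) (lt_min hδ (by positivity))
    have htt : t < t₀ := by linarith [htle.trans (min_le_right _ _)]
    obtain ⟨w, hw1, hw2⟩ := happ u M t ht htt hM.le hB
    refine ⟨w, hw1, hw2.trans (ENNReal.ofReal_le_ofReal ?_)⟩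
    rw [← hδk]
    gcongr
    exact hΨ.mono ht (htle.trans (min_le_left _ _))
  choose w hwE hwu using hseq
  have hlim : Tendsto (fun k => domainInclusion 𝓔.toPEnergyForm (w k)) atTop (𝓝 u) := by
    refine tendsto_Lp_of_lintegral _ u (tendsto_of_tendsto_of_tendsto_of_le_of_le
      tendsto_const_nhds ?_ (fun k => zero_le) hwu)
    have h1 : Tendsto (fun k : ℕ => K * (M + 1) * (1 / ((k : ℝ) + 1))) atTop (𝓝 0) := by
      simpa using tendsto_one_div_add_atTop_nhds_zero_nat.const_mul (K * (M + 1))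
    simpa using ENNReal.tendsto_ofReal h1
  -- With the whole domain as subspace, closure carries no information; what matters is that u is
  -- the image of a weak limit in the domain.
  obtain ⟨x, -, hx⟩ := exists_mem_closure_of_tendsto 𝓔 ⊤ w (fun _ => Submodule.mem_top)
    ((K * (M + 1)) ^ (1 / p)) (fun k => by
      have h1 := hwE k
      rw [← ENNReal.ofReal_coe_nnreal, ENNReal.ofReal_le_ofReal_iff (by positivity)] at h1
      gcongr) u hlim
  rw [← hx]
  exact (show 𝓔.F from x).2

end Lower

end EnergyForms

end

theorem mainTheorem4 {X : Type*} [MetricSpace X] [LocallyCompactSpace X]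
    [TopologicalSpace.SeparableSpace X] [CompleteSpace X] [Nontrivial X]
    [MeasurableSpace X] [BorelSpace X]
    (m : Measure X) [IsLocallyFiniteMeasure m] [m.IsOpenPosMeasure]
    (p : ℝ) [Fact (1 < p)] (𝓔 : EnergyStructure m p)
    (Ψ : ℝ → ℝ) (hΨ : IsScaleFunction Ψ)
    (hVD : VolumeDoubling m) (hPI : PoincareInequality 𝓔 Ψ) (hcap : CapacityUpperBound 𝓔 Ψ)
    (ρ : ℝ → X → X → ℝ≥0)
    (hρm : ∀ ε : ℝ, 0 < ε → Measurable fun z : X × X => ρ ε z.1 z.2)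
    (hρ : KernelAssumption₁ m Ψ ρ ∨ KernelAssumption₂ m Ψ ρ) :
    (𝓔.F : Set (Lp ℝ (ENNReal.ofReal p) m)) =
        {u : Lp ℝ (ENNReal.ofReal p) m | liminf (fun ε => besovFunctional m p Ψ (ρ ε) u) (𝓝[>] 0) < ∞} ∧
      (𝓔.F : Set (Lp ℝ (ENNReal.ofReal p) m)) =
        {u : Lp ℝ (ENNReal.ofReal p) m | limsup (fun ε => besovFunctional m p Ψ (ρ ε) u) (𝓝[>] 0) < ∞} := by
  have key : ∀ u : Lp ℝ (ENNReal.ofReal p) m, u ∈ 𝓔.F →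
      limsup (fun ε => besovFunctional m p Ψ (ρ ε) u) (𝓝[>] 0) < ∞ := by
    intro u hu
    rcases hρ with ⟨C, -, h1, h2, -⟩ | ⟨C, -, h1, -⟩
    · exact limsup_besovFunctional_lt_top_of_fixed hPI hΨ hVD hρm h1 h2 ⟨u, hu⟩
    · exact limsup_besovFunctional_lt_top_of_local hPI hΨ hVD h1 ⟨u, hu⟩
  have hle : ∀ u : Lp ℝ (ENNReal.ofReal p) m,
      liminf (fun ε => besovFunctional m p Ψ (ρ ε) u) (𝓝[>] 0) ≤
        limsup (fun ε => besovFunctional m p Ψ (ρ ε) u) (𝓝[>] 0) := fun u => liminf_le_limsup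
  have hmem : ∀ u : Lp ℝ (ENNReal.ofReal p) m,
      liminf (fun ε => besovFunctional m p Ψ (ρ ε) u) (𝓝[>] 0) < ∞ → u ∈ 𝓔.F := by
    intro u hu
    rcases hρ with ⟨C, hC, -, -, h⟩ | ⟨C, hC, -, h⟩
    · exact mem_domain_of_liminf_besovFunctional hcap hΨ hVD hC h u hu
    · exact mem_domain_of_liminf_besovFunctional hcap hΨ hVD hC h u hu
  exact ⟨Set.ext fun u => ⟨fun hu => (hle u).trans_lt (key u hu), hmem u⟩,
    Set.ext fun u => ⟨key u, fun hu => hmem u ((hle u).trans_lt hu)⟩⟩
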